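/- Let $1\le n\le 3$ and let $\Omega\subset\mathbb{R}^n$ be a bounded domain with locally Lipschitz boundary. Let $a,b,\alpha,\beta,q,r,J>0$ and $c\in\mathbb{R}$ be constants. Put $H=L^2(\Omega,\mathbb{R}^3)$, with norm $\|\cdot\|$ and inner product $\langle\cdot,\cdot\rangle$, and $E=H^1(\Omega,\mathbb{R}^3)$, with norm $\|g\|_E^2=\|\nabla g\|^2+\|g\|^2$. Then the Hindmarsh–Rose nonlinearity $$f(u,v,w)=\bigl(au^2-bu^3+v-w+J,\ \ \alpha-\beta u^2-v,\ \ q(u-c)-rw\bigr)$$ defines, by superposition, a mapping $f:E\to H$ with the following properties. (1) For every bounded set $M\subset E$ (in particular, for every bounded set that is positively invariant under the semiflow of the diffusive Hindmarsh–Rose equations) there is a constant $C_E(M)>0$ such that $$\|f(g)-f(\tilde g)\|\le C_E(M)\,\|g-\tilde g\|_E\qquad\text{for all } g,\tilde g\in M.$$ (2) With the positive constant $$C^*=\max\Bigl\{1+q+\frac{2a^2}{b},\ 2+\frac{2\beta^2}{b},\ 1+q+r\Bigr\},$$ one has $$\langle f(g)-f(\tilde g),\,g-\tilde g\rangle\le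 C^*\,\|g-\tilde g\|^2\qquad\text{for all } g,\tilde g\in E,$$ so $C^*$ serves for every set $M\subset E$. -/

import Mathlib

open MeasureTheory
open scoped NNReal ContDiff

/-- A bounded domain of `ℝⁿ` (nonempty, open, connected) with locally Lipschitz boundary: near
every boundary point `x₀`, in suitable orthonormal coordinates whose last axis is spanned by the
unit vector `e`, the set `Ω` is the strict epigraph of a Lipschitz function `γ` of the remaining
coordinates `x - ⟪e, x⟫ e`. -/
structure IsBoundedLipschitzDomain {n : ℕ} (Ω : Set (EuclideanSpace ℝ (Fin n))) : Prop where
  isOpen : IsOpen Ω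
  isConnected : IsConnected Ω
  isBounded : Bornology.IsBounded Ω
  lipschitz_boundary : ∀ x₀ ∈ frontier Ω, ∃ (δ : ℝ) (e : EuclideanSpace ℝ (Fin n)) (K : ℝ≥0)
    (γ : EuclideanSpace ℝ (Fin n) → ℝ), 0 < δ ∧ ‖e‖ = 1 ∧ LipschitzWith K γ ∧
      ∀ x ∈ Metric.ball x₀ δ, (x ∈ Ω ↔ γ (x - inner ℝ e x • e) < inner ℝ e x)

/-- `G` is the weak (distributional) gradient of `u` on `Ω`: for every test function
`η ∈ C_c^∞(Ω)` and every `i`, `∫_Ω u ∂ᵢη = - ∫_Ω Gᵢ η`. -/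
def HasWeakGradient {n : ℕ} (Ω : Set (EuclideanSpace ℝ (Fin n)))
    (u : EuclideanSpace ℝ (Fin n) → ℝ)
    (G : EuclideanSpace ℝ (Fin n) → EuclideanSpace ℝ (Fin n)) : Prop :=
  ∀ η : EuclideanSpace ℝ (Fin n) → ℝ, ContDiff ℝ ∞ η → HasCompactSupport η → tsupport η ⊆ Ω →
    ∀ i : Fin n, ∫ x in Ω, u x * fderiv ℝ η x (EuclideanSpace.single i 1)
      = - ∫ x in Ω, G x i * η x

/-- The Hilbert space `L²(Ω)`. -/
abbrev SpaceL2 {n : ℕ} (Ω : Set (EuclideanSpace ℝ (Fin n))) : Type :=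
  Lp ℝ 2 (volume.restrict Ω)

/-- The Hilbert space `L²(Ω, ℝⁿ)` of square integrable vector fields. -/
abbrev SpaceL2Vec {n : ℕ} (Ω : Set (EuclideanSpace ℝ (Fin n))) : Type :=
  Lp (EuclideanSpace ℝ (Fin n)) 2 (volume.restrict Ω)

theorem memLp_testFunction {n : ℕ} (Ω : Set (EuclideanSpace ℝ (Fin n)))
    {η : EuclideanSpace ℝ (Fin n) → ℝ} (hη : Continuous η) (hc : HasCompactSupport η) :
    MemLp η 2 (volume.restrict Ω) :=
  (hη.memLp_of_hasCompactSupport (μ := volume) (p := 2) hc).restrict Ω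

theorem memLp_testFunction_deriv {n : ℕ} (Ω : Set (EuclideanSpace ℝ (Fin n)))
    {η : EuclideanSpace ℝ (Fin n) → ℝ} (hη : ContDiff ℝ ∞ η) (hc : HasCompactSupport η)
    (v : EuclideanSpace ℝ (Fin n)) :
    MemLp (fun x => fderiv ℝ η x v) 2 (volume.restrict Ω) :=
  memLp_testFunction Ω ((hη.continuous_fderiv (by simp)).clm_apply continuous_const)
    (hc.fderiv_apply ℝ v)

theorem memLp_component {n : ℕ} {Ω : Set (EuclideanSpace ℝ (Fin n))} (G : SpaceL2Vec Ω)
    (i : Fin n) : MemLp (fun x => G x i) 2 (volume.restrict Ω) :=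
  (EuclideanSpace.proj i : EuclideanSpace ℝ (Fin n) →L[ℝ] ℝ).comp_memLp' (Lp.memLp G)

/-- The Sobolev space `H¹(Ω)`, consisting of the pairs `(u, ∇u)` with `u ∈ L²(Ω)` and weak gradient
`∇u ∈ L²(Ω, ℝⁿ)`. (The second entry is determined by the first when `Ω` is open.) As a subspace of
the Hilbert sum of `L²(Ω)` and `L²(Ω, ℝⁿ)` it carries the norm given by
`‖u‖² + ‖∇u‖²`. -/
def SobolevH1 {n : ℕ} (Ω : Set (EuclideanSpace ℝ (Fin n))) :
    Submodule ℝ (WithLp 2 (SpaceL2 Ω × SpaceL2Vec Ω)) where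
  carrier := {p | HasWeakGradient Ω p.fst p.snd}
  zero_mem' := by
    intro η hη hc hs i
    have h1 : ∀ᵐ x ∂(volume.restrict Ω),
        (WithLp.fst (0 : WithLp 2 (SpaceL2 Ω × SpaceL2Vec Ω)) : SpaceL2 Ω) x = 0 :=
      Lp.coeFn_zero ℝ 2 (volume.restrict Ω)
    have h2 : ∀ᵐ x ∂(volume.restrict Ω),
        (WithLp.snd (0 : WithLp 2 (SpaceL2 Ω × SpaceL2Vec Ω)) : SpaceL2Vec Ω) x = 0 :=
      Lp.coeFn_zero (EuclideanSpace ℝ (Fin n)) 2 (volume.restrict Ω)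
    rw [integral_eq_zero_of_ae (by filter_upwards [h1] with x hx; rw [hx, zero_mul]; rfl),
      integral_eq_zero_of_ae (by filter_upwards [h2] with x hx; rw [hx]; simp)]
    simp
  add_mem' := by
    intro p p' hp hp' η hη hc hs i
    have h1 : ∀ᵐ x ∂(volume.restrict Ω), (p + p').fst x = p.fst x + p'.fst x :=
      Lp.coeFn_add p.fst p'.fst
    have h2 : ∀ᵐ x ∂(volume.restrict Ω), (p + p').snd x = p.snd x + p'.snd x :=
      Lp.coeFn_add p.snd p'.snd
    have hd := memLp_testFunction_deriv Ω hη hc (EuclideanSpace.single i 1)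
    have hm := memLp_testFunction Ω hη.continuous hc
    have e1 : ∫ x in Ω, (p + p').fst x * fderiv ℝ η x (EuclideanSpace.single i 1)
        = (∫ x in Ω, p.fst x * fderiv ℝ η x (EuclideanSpace.single i 1))
          + ∫ x in Ω, p'.fst x * fderiv ℝ η x (EuclideanSpace.single i 1) := by
      refine Eq.trans (integral_congr_ae ?_) (integral_add
        ((Lp.memLp p.fst).integrable_mul hd) ((Lp.memLp p'.fst).integrable_mul hd))
      filter_upwards [h1] with x hx
      simp only [hx, add_mul]
    have e2 : ∫ x in Ω, (p + p').snd x i * η x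
        = (∫ x in Ω, p.snd x i * η x) + ∫ x in Ω, p'.snd x i * η x := by
      refine Eq.trans (integral_congr_ae ?_) (integral_add
        ((memLp_component p.snd i).integrable_mul hm)
        ((memLp_component p'.snd i).integrable_mul hm))
      filter_upwards [h2] with x hx
      simp only [hx, add_mul, PiLp.add_apply]
    rw [e1, e2, hp η hη hc hs i, hp' η hη hc hs i]
    ring
  smul_mem' := by
    intro k p hp η hη hc hs i
    have h1 : ∀ᵐ x ∂(volume.restrict Ω), (k • p).fst x = k * p.fst x :=
      Lp.coeFn_smul k p.fst
    have h2 : ∀ᵐ x ∂(volume.restrict Ω), (k • p).snd x = k • p.snd x :=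
      Lp.coeFn_smul k p.snd
    have e1 : ∫ x in Ω, (k • p).fst x * fderiv ℝ η x (EuclideanSpace.single i 1)
        = k * ∫ x in Ω, p.fst x * fderiv ℝ η x (EuclideanSpace.single i 1) := by
      rw [← integral_const_mul]
      refine integral_congr_ae ?_
      filter_upwards [h1] with x hx
      simp only [hx, mul_assoc]
    have e2 : ∫ x in Ω, (k • p).snd x i * η x = k * ∫ x in Ω, p.snd x i * η x := by
      rw [← integral_const_mul]
      refine integral_congr_ae ?_
      filter_upwards [h2] with x hx
      simp only [hx, mul_assoc, PiLp.smul_apply, smul_eq_mul]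
    rw [e1, e2, hp η hη hc hs i]
    ring

/-- `H = [L²(Ω)]³ = L²(Ω, ℝ³)` with its Hilbert space norm and inner product. -/
abbrev SpaceH {n : ℕ} (Ω : Set (EuclideanSpace ℝ (Fin n))) : Type :=
  PiLp 2 (fun _ : Fin 3 => SpaceL2 Ω)

/-- `E = [H¹(Ω)]³ = H¹(Ω, ℝ³)` with the norm `‖g‖_E² = ‖∇g‖² + ‖g‖²`. -/
abbrev SpaceE {n : ℕ} (Ω : Set (EuclideanSpace ℝ (Fin n))) : Type :=
  PiLp 2 (fun _ : Fin 3 => SobolevH1 Ω)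

/-- The inclusion `E ⊂ H`, `(u, v, w) ↦ (u, v, w)` (forgetting the gradients). -/
def SpaceE.toH {n : ℕ} {Ω : Set (EuclideanSpace ℝ (Fin n))} (g : SpaceE Ω) : SpaceH Ω :=
  WithLp.toLp 2 (fun i => (g i : WithLp 2 (SpaceL2 Ω × SpaceL2Vec Ω)).fst)

/-- The Hindmarsh-Rose reaction terms, with `φ(u) = a u² - b u³` and `ψ(u) = α - β u²`, evaluated at
`(u, v, w)`: `(φ(u) + v - w + J, ψ(u) - v, q (u - c) - r w)`. -/
def hindmarshRose (a b α β q r J c u v w : ℝ) : Fin 3 → ℝ :=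
  ![(a * u ^ 2 - b * u ^ 3) + v - w + J, (α - β * u ^ 2) - v, q * (u - c) - r * w]

/-- `f : E → H` is the Nemytskii (superposition) operator of the Hindmarsh-Rose reaction terms:
each component of `f(u, v, w)` is, almost everywhere in `Ω`, the corresponding reaction term at
`(u(x), v(x), w(x))`. There is at most one such `f`, and there is one exactly when the
superposition maps `E` into `H`. -/
def IsHindmarshRoseNemytskii {n : ℕ} (Ω : Set (EuclideanSpace ℝ (Fin n)))
    (a b α β q r J c : ℝ) (f : SpaceE Ω → SpaceH Ω) : Prop :=
  ∀ (g : SpaceE Ω) (i : Fin 3), ∀ᵐ x ∂(volume.restrict Ω),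
    f g i x = hindmarshRose a b α β q r J c (g.toH 0 x) (g.toH 1 x) (g.toH 2 x) i

/-- The one-sided constant `max {1 + q + 2a²/b, 2 + 2β²/b, 1 + q + r}`. -/
noncomputable def hindmarshRoseConst (a b β q r : ℝ) : ℝ :=
  max (1 + q + 2 * a ^ 2 / b) (max (2 + 2 * β ^ 2 / b) (1 + q + r))

/-!
The nonlinearity is cubic, so everything rests on the Sobolev embedding `H¹(Ω) ⊂ L⁶(Ω)` in dimension
at most three. Once it is available, the pointwise bound
`|f(g) - f(g')| ≤ K (1 + u² + u'²) (|u - u'| + |v - v'| + |w - w'|)` and Hölder's inequality with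
`1/2 = 1/3 + 1/6` give both the existence of the superposition operator and its Lipschitz estimate
on bounded sets. The one-sided estimate is a pointwise inequality
(`sum_hindmarshRose_sub_mul_le`), integrated over `Ω`.

The embedding (`IsBoundedLipschitzDomain.exists_const_lintegral_enorm_pow_six_le`) is proved without
an extension operator. Near each point of `closure Ω` there is an open set `U` of directions along
which `Ω` cannot be left locally (`IsBoundedLipschitzDomain.exists_open_directions`): the
directions of an open cone around the axis of the epigraph. This is used twice.

* Gagliardo's argument bounds a function by the integrals of its gradient along lines parallel to
  the axes. Taking axes with directions in `-U`, the half-line from a point of `Ω` that is used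
  stays in `Ω` as long as it meets the support of the function, so that only the gradient inside
  `Ω` enters (`lintegral_enorm_pow_six_le`, whose combinatorial core is Mathlib's grid-lines lemma
  `MeasureTheory.lintegral_prod_lintegral_pow_le`).
* Mollifying with a kernel that looks only in directions of `U` produces smooth functions whose
  gradient on `Ω` near the point is the mollified weak gradient
  (`HasWeakGradient.fderiv_convolution`).

The estimate for the mollified functions, cut off near the point, passes to the limit by Fatou's
lemma (`exists_const_lintegral_inter_ball_le`), and the compactness of `closure Ω` finishes the
proof.
-/

/-! ### Gagliardo's inequality on sets closed under decreasing coordinates -/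

/-- The fundamental theorem of calculus for `W ^ (m + 1)` along the half-line below `x` in the
`i`-th coordinate. The half-line only has to stay in `S` where the derivative of `W` is nonzero, so
the integrand may be cut off outside `S`. -/
theorem enorm_pow_succ_le_lintegral_update {ι : Type*} [Fintype ι] [DecidableEq ι]
    {W : (ι → ℝ) → ℝ} (hW : ContDiff ℝ 1 W) (hc : HasCompactSupport W) {S : Set (ι → ℝ)}
    {x : ι → ℝ} {i : ι}
    (hS : ∀ t ≤ x i, Function.update x i t ∈ S ∨ fderiv ℝ W (Function.update x i t) = 0) (m : ℕ) :
    ‖W x‖ₑ ^ (m + 1) ≤ ∫⁻ t, S.indicator (fun y => (m + 1) * ‖W y‖ₑ ^ m * ‖fderiv ℝ W y‖ₑ)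
      (Function.update x i t) := by
  set V : (ι → ℝ) → ℝ := fun y => W y ^ (m + 1) with hV
  have hVd : ContDiff ℝ 1 V := hW.pow (m + 1)
  have hVc : HasCompactSupport V := by
    refine hc.mono fun y hy => ?_
    rw [Function.mem_support] at hy ⊢
    exact fun h => hy (by simp [hV, h])
  have hle : ∀ y, ‖fderiv ℝ V y‖ₑ ≤ (m + 1) * ‖W y‖ₑ ^ m * ‖fderiv ℝ W y‖ₑ := by
    intro y
    have hd : DifferentiableAt ℝ W y := (hW.differentiable one_ne_zero).differentiableAt
    have : fderiv ℝ V y = ((m + 1 : ℕ) * W y ^ m) • fderiv ℝ W y := by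
      have h := (hd.hasFDerivAt.pow (m + 1)).fderiv
      simpa [hV] using h
    rw [this, enorm_smul, enorm_mul, enorm_pow]
    refine le_of_eq ?_
    congr 2
    rw [← ofReal_norm]
    simp
    norm_cast
  calc ‖W x‖ₑ ^ (m + 1) = ‖V x‖ₑ := by simp [hV, enorm_pow]
    _ ≤ ∫⁻ t in Set.Iic (x i), ‖deriv (V ∘ Function.update x i) t‖ₑ := by
        refine le_trans (by simp) (HasCompactSupport.enorm_le_lintegral_Ici_deriv ?_ ?_ _)
        · exact hVd.comp (by convert! contDiff_update 1 x i)
        · exact hVc.comp_isClosedEmbedding (isClosedEmbedding_update x i)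
    _ ≤ ∫⁻ t in Set.Iic (x i), S.indicator
          (fun y => (m + 1) * ‖W y‖ₑ ^ m * ‖fderiv ℝ W y‖ₑ) (Function.update x i t) := by
        refine setLIntegral_mono' measurableSet_Iic fun t ht => ?_
        have h1 : ‖deriv (V ∘ Function.update x i) t‖ₑ ≤ ‖fderiv ℝ V (Function.update x i t)‖ₑ := by
          rw [fderiv_comp_deriv _ (hVd.differentiable one_ne_zero).differentiableAt
            (hasDerivAt_update x i t).differentiableAt]
          refine (ContinuousLinearMap.le_opENorm _ _).trans ?_
          simp [deriv_update, Pi.enorm_single]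
        refine h1.trans ((hle _).trans ?_)
        rcases hS t ht with h | h
        · rw [Set.indicator_of_mem h]
        · have h0 : ‖fderiv ℝ W (Function.update x i t)‖ₑ = 0 := by rw [← ofReal_norm, h]; simp
          simp [h0]
    _ ≤ _ := setLIntegral_le_lintegral _ _

section
variable {n : ℕ} {W : (Fin n → ℝ) → ℝ} {S : Set (Fin n → ℝ)}

/-- The Cauchy-Schwarz inequality, in squared form. -/
theorem sq_lintegral_mul_le {α : Type*} [MeasurableSpace α] {μ : Measure α}
    {f g : α → ENNReal} (hf : AEMeasurable f μ) (hg : AEMeasurable g μ) :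
    (∫⁻ x, f x * g x ∂μ) ^ 2 ≤ (∫⁻ x, f x ^ 2 ∂μ) * ∫⁻ x, g x ^ 2 ∂μ := by
  have h := ENNReal.lintegral_mul_le_Lp_mul_Lq μ Real.HolderConjugate.two_two hf hg
  have h2 := ENNReal.rpow_le_rpow h (show (0:ℝ) ≤ 2 by norm_num)
  rw [ENNReal.mul_rpow_of_nonneg _ _ (by norm_num), ← ENNReal.rpow_mul, ← ENNReal.rpow_mul] at h2
  norm_num at h2
  simpa using h2

theorem sq_lintegral_indicator_le (hW : ContDiff ℝ 1 W) (hS : MeasurableSet S) (m : ℕ) :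
    (∫⁻ y, S.indicator (fun y => (m + 1) * ‖W y‖ₑ ^ m * ‖fderiv ℝ W y‖ₑ) y) ^ 2
      ≤ (m + 1) ^ 2 * (∫⁻ y in S, ‖W y‖ₑ ^ (2 * m)) * ∫⁻ y in S, ‖fderiv ℝ W y‖ₑ ^ 2 := by
  have hWc : Continuous W := hW.continuous
  have hDc : Continuous (fderiv ℝ W) := hW.continuous_fderiv one_ne_zero
  rw [lintegral_indicator hS]
  refine (sq_lintegral_mul_le (f := fun y => (m + 1) * ‖W y‖ₑ ^ m)
    (by fun_prop) (by fun_prop)).trans (le_of_eq ?_)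
  congr 1
  rw [← lintegral_const_mul _ (by fun_prop)]
  refine lintegral_congr fun y => ?_
  rw [mul_pow, ← pow_mul, mul_comm m 2]

theorem lintegral_enorm_pow_lt_top (hW : Continuous W) (hc : HasCompactSupport W) {k : ℕ}
    (hk : k ≠ 0) : ∫⁻ y in S, ‖W y‖ₑ ^ k < ⊤ := by
  have h : Integrable (fun y => W y ^ k) (volume.restrict S) := by
    refine ((hW.pow k).integrable_of_hasCompactSupport (hc.mono fun y hy => ?_)).restrict
    rw [Function.mem_support] at hy ⊢
    exact fun h => hy (by simp [h, hk])
  simpa [enorm_pow, HasFiniteIntegral] using h.2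

/-- Gagliardo's inequality for `W ^ (m + 1)`, with integrals over `S` only. -/
theorem lintegral_grid_le (hn : 2 ≤ n) (hW : ContDiff ℝ 1 W) (hc : HasCompactSupport W)
    (hSm : MeasurableSet S)
    (hS : ∀ x ∈ S, W x ≠ 0 → ∀ i, ∀ t ≤ x i,
      Function.update x i t ∈ S ∨ fderiv ℝ W (Function.update x i t) = 0) (m : ℕ)
    {p : ℝ} (hp : Real.HolderConjugate n p) :
    ∫⁻ x in S, (‖W x‖ₑ ^ (m + 1)) ^ p ≤
      (∫⁻ y, S.indicator (fun y => (m + 1) * ‖W y‖ₑ ^ m * ‖fderiv ℝ W y‖ₑ) y) ^ p := by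
  have hWc : Continuous W := hW.continuous
  have hDc : Continuous (fderiv ℝ W) := hW.continuous_fderiv one_ne_zero
  have hp' : Real.HolderConjugate (Fintype.card (Fin n)) p := by simpa using hp
  have hn' : (2:ℝ) ≤ n := by exact_mod_cast hn
  refine le_trans ?_ (lintegral_prod_lintegral_pow_le (fun _ => volume) hp'
    (f := S.indicator (fun y => (m + 1) * ‖W y‖ₑ ^ m * ‖fderiv ℝ W y‖ₑ))
    (Measurable.indicator (by fun_prop) hSm))
  rw [← volume_pi, ← lintegral_indicator hSm]
  refine lintegral_mono fun x => ?_
  by_cases hx : x ∈ S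
  swap
  · simp [hx]
  rw [Set.indicator_of_mem hx]
  by_cases hWx : W x = 0
  · simp [hWx, hp.symm.pos]
  calc (‖W x‖ₑ ^ (m + 1)) ^ p = ((‖W x‖ₑ ^ (m + 1)) ^ (1 / (n - 1 : ℝ))) ^ (n : ℝ) := by
        rw [← ENNReal.rpow_mul, hp.conjugate_eq]
        congr 1
        field_simp
    _ = ∏ _i : Fin n, (‖W x‖ₑ ^ (m + 1)) ^ (1 / (n - 1 : ℝ)) := by simp
    _ ≤ _ := by
        rw [Fintype.card_fin]
        refine Finset.prod_le_prod' fun i _ => ENNReal.rpow_le_rpow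
          (enorm_pow_succ_le_lintegral_update hW hc (hS x hx hWx i) m) ?_
        exact div_nonneg zero_le_one (by linarith)

/-- The Sobolev inequality on `S` in dimension at most three. The exponents come from Gagliardo's
inequality: `m + 1 = 4` in dimension three, `m + 1 = 2` and then `3` in dimension two, and
`m + 1 = 2` in dimension one. -/
theorem lintegral_enorm_pow_six_le (hn : 1 ≤ n) (hn3 : n ≤ 3) (hW : ContDiff ℝ 1 W)
    (hc : HasCompactSupport W) (hSm : MeasurableSet S)
    (hS : ∀ x ∈ S, W x ≠ 0 → ∀ i, ∀ t ≤ x i,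
      Function.update x i t ∈ S ∨ fderiv ℝ W (Function.update x i t) = 0) :
    ∫⁻ x in S, ‖W x‖ₑ ^ 6 ≤
      4096 * ((∫⁻ x in S, ‖W x‖ₑ ^ 2) + ∫⁻ x in S, ‖fderiv ℝ W x‖ₑ ^ 2) ^ 3 := by
  have hcs := fun m => sq_lintegral_indicator_le hW hSm m
  set A := ∫⁻ x in S, ‖W x‖ₑ ^ 2 with hA
  set D := ∫⁻ x in S, ‖fderiv ℝ W x‖ₑ ^ 2 with hD
  -- used by the `gcongr` calls below
  have hAle : A ≤ A + D := le_self_add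
  have hDle : D ≤ A + D := le_add_self
  obtain rfl | rfl | rfl : n = 1 ∨ n = 2 ∨ n = 3 := by omega
  · -- in one dimension `|W|²` is bounded pointwise
    have hpt : ∀ x ∈ S, ‖W x‖ₑ ^ 4 ≤ 4 * A * D := by
      intro x hx
      by_cases hWx : W x = 0
      · simp [hWx]
      have h1 := enorm_pow_succ_le_lintegral_update hW hc (hS x hx hWx 0) 1
      have h2 : ∀ F : (Fin 1 → ℝ) → ENNReal,
          ∫⁻ t, F (Function.update x 0 t) = ∫⁻ y, F y := by
        intro F
        refine Eq.trans ?_ (((volume_preserving_funUnique (Fin 1) ℝ).symm _).lintegral_comp_emb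
          (MeasurableEquiv.measurableEmbedding _) F)
        refine lintegral_congr fun t => ?_
        congr 1
        ext i
        fin_cases i
        simp
      rw [h2] at h1
      calc ‖W x‖ₑ ^ 4 = (‖W x‖ₑ ^ (1 + 1)) ^ 2 := by rw [← pow_mul]
        _ ≤ _ := pow_le_pow_left' h1 2
        _ ≤ _ := hcs 1
        _ = 4 * A * D := by norm_num [hA]
    calc ∫⁻ x in S, ‖W x‖ₑ ^ 6 ≤ ∫⁻ x in S, (4 * A * D) * ‖W x‖ₑ ^ 2 := by
          refine setLIntegral_mono' hSm fun x hx => ?_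
          calc ‖W x‖ₑ ^ 6 = ‖W x‖ₑ ^ 4 * ‖W x‖ₑ ^ 2 := by rw [← pow_add]
            _ ≤ _ := by gcongr; exact hpt x hx
      _ = (4 * A * D) * A := by
          have hWc : Continuous W := hW.continuous
          rw [lintegral_const_mul _ (by fun_prop)]
      _ ≤ (4 * (A + D) * (A + D)) * (A + D) := by gcongr
      _ = 4 * (A + D) ^ 3 := by ring
      _ ≤ _ := by gcongr; norm_num
  · have hp : Real.HolderConjugate (2 : ℕ) 2 := by exact_mod_cast Real.HolderConjugate.two_two
    have h4 := (lintegral_grid_le le_rfl hW hc hSm hS 1 hp)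
    have h6 := (lintegral_grid_le le_rfl hW hc hSm hS 2 hp)
    simp only [ENNReal.rpow_ofNat, ← pow_mul] at h4 h6
    have h4' : ∫⁻ x in S, ‖W x‖ₑ ^ 4 ≤ 4 * A * D := by
      refine h4.trans ((hcs 1).trans_eq ?_)
      norm_num [hA]
    calc ∫⁻ x in S, ‖W x‖ₑ ^ 6 ≤ _ := h6
      _ ≤ _ := hcs 2
      _ ≤ 9 * (4 * A * D) * D := by
          gcongr
          · norm_num
      _ ≤ 9 * (4 * (A + D) * (A + D)) * (A + D) := by gcongr
      _ = 36 * (A + D) ^ 3 := by ring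
      _ ≤ _ := by gcongr; norm_num
  · have hp : Real.HolderConjugate (3 : ℕ) (3 / 2) := by
      rw [Real.holderConjugate_iff]; norm_num
    have h6 := (lintegral_grid_le (by norm_num) hW hc hSm hS 3 hp)
    have hB := hcs 3
    set F := ∫⁻ y, S.indicator (fun y => ((3 : ℕ) + 1) * ‖W y‖ₑ ^ 3 * ‖fderiv ℝ W y‖ₑ) y
    set B := ∫⁻ x in S, ‖W x‖ₑ ^ 6 with hBdef
    have hBtop : B ≠ ⊤ := (lintegral_enorm_pow_lt_top hW.continuous hc (by norm_num)).ne
    have h6' : B ≤ F ^ (3 / 2 : ℝ) := by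
      refine le_trans (le_of_eq ?_) h6
      refine lintegral_congr fun x => ?_
      rw [← ENNReal.rpow_natCast, ← ENNReal.rpow_natCast, ← ENNReal.rpow_mul]
      norm_num
    have hB' : F ^ 2 ≤ 16 * B * D := by
      refine hB.trans_eq ?_
      norm_num
    -- `B⁴ ≤ F⁶ ≤ (16 B D)³`, and the finite factor `B³` cancels
    have h : B ^ 3 * B ≤ B ^ 3 * (4096 * D ^ 3) := by
      calc B ^ 3 * B = B ^ 4 := by ring
        _ ≤ (F ^ (3 / 2 : ℝ)) ^ 4 := pow_le_pow_left' h6' 4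
        _ = (F ^ 2) ^ 3 := by
          rw [← pow_mul, ← ENNReal.rpow_natCast, ← ENNReal.rpow_natCast, ← ENNReal.rpow_mul]
          norm_num
        _ ≤ (16 * B * D) ^ 3 := pow_le_pow_left' hB' 3
        _ = _ := by ring
    by_cases hB0 : B = 0
    · simp [hB0]
    · rw [ENNReal.mul_le_mul_iff_right (pow_ne_zero 3 hB0) (ENNReal.pow_ne_top hBtop)] at h
      exact h.trans (by gcongr)
end

/-! ### Mollification -/

section
open scoped Convolution
open ContinuousLinearMap Filter Topology

variable {E : Type*} [NormedAddCommGroup E] [NormedSpace ℝ E] [FiniteDimensional ℝ E]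
  [MeasurableSpace E] [BorelSpace E] {μ : Measure E} [μ.IsAddHaarMeasure]
  {V : Type*} [NormedAddCommGroup V] [NormedSpace ℝ V]

/-- Mollification does not increase the `L²` norm. -/
theorem lintegral_enorm_convolution_sq_le {ψ : E → ℝ} (hψ : Continuous ψ)
    (hψ1 : ∫⁻ t, ‖ψ t‖ₑ ∂μ = 1) {F : E → V} (hF : StronglyMeasurable F) :
    ∫⁻ x, ‖(ψ ⋆[lsmul ℝ ℝ, μ] F) x‖ₑ ^ 2 ∂μ ≤ ∫⁻ x, ‖F x‖ₑ ^ 2 ∂μ := by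
  have hFm : Measurable fun x => ‖F x‖ₑ := hF.enorm
  have hψm : Measurable fun x => ‖ψ x‖ₑ := by fun_prop
  have hsq : ∀ a : ENNReal, (a ^ (1 / 2 : ℝ)) ^ 2 = a := fun a => by
    rw [← ENNReal.rpow_natCast, ← ENNReal.rpow_mul]; norm_num
  have hpt : ∀ x, ‖(ψ ⋆[lsmul ℝ ℝ, μ] F) x‖ₑ ^ 2 ≤ ∫⁻ t, ‖ψ t‖ₑ * ‖F (x - t)‖ₑ ^ 2 ∂μ := by
    intro x
    have hFx : Measurable fun t => ‖F (x - t)‖ₑ := hFm.comp (measurable_const_sub x)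
    calc ‖(ψ ⋆[lsmul ℝ ℝ, μ] F) x‖ₑ ^ 2
        ≤ (∫⁻ t, ‖ψ t‖ₑ ^ (1 / 2 : ℝ) * (‖ψ t‖ₑ ^ (1 / 2 : ℝ) * ‖F (x - t)‖ₑ) ∂μ) ^ 2 := by
          refine pow_le_pow_left' ((enorm_integral_le_lintegral_enorm _).trans_eq ?_) 2
          refine lintegral_congr fun t => ?_
          rw [lsmul_apply, enorm_smul, ← mul_assoc, ← sq, hsq]
      _ ≤ _ := sq_lintegral_mul_le (by fun_prop) (by fun_prop)
      _ = _ := by simp only [mul_pow, hsq, hψ1, one_mul]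
  calc ∫⁻ x, ‖(ψ ⋆[lsmul ℝ ℝ, μ] F) x‖ₑ ^ 2 ∂μ
      ≤ ∫⁻ x, ∫⁻ t, ‖ψ t‖ₑ * ‖F (x - t)‖ₑ ^ 2 ∂μ ∂μ := lintegral_mono hpt
    _ = ∫⁻ t, ∫⁻ x, ‖ψ t‖ₑ * ‖F (x - t)‖ₑ ^ 2 ∂μ ∂μ := by
        refine lintegral_lintegral_swap (Measurable.aemeasurable ?_)
        have h1 : Measurable fun p : E × E => ‖F (p.1 - p.2)‖ₑ :=
          hFm.comp (measurable_fst.sub measurable_snd)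
        have h2 : Measurable fun p : E × E => ‖ψ p.2‖ₑ := hψm.comp measurable_snd
        exact h2.mul (h1.pow_const 2)
    _ = ∫⁻ t, ‖ψ t‖ₑ * ∫⁻ x, ‖F x‖ₑ ^ 2 ∂μ ∂μ := by
        refine lintegral_congr fun t => ?_
        have h1 : Measurable fun x => ‖F (x - t)‖ₑ := hFm.comp (measurable_sub_const t)
        rw [lintegral_const_mul _ (by fun_prop),
          lintegral_sub_right_eq_self (fun x => ‖F x‖ₑ ^ 2) t]
    _ = _ := by rw [lintegral_mul_const _ hψm, hψ1, one_mul]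

theorem ContDiffBump.lintegral_enorm_normed (φ : ContDiffBump (0 : E)) :
    ∫⁻ t, ‖φ.normed μ t‖ₑ ∂μ = 1 := by
  have h := ofReal_integral_eq_lintegral_ofReal (φ.integrable_normed (μ := μ))
    (Eventually.of_forall fun t => φ.nonneg_normed t)
  rw [φ.integral_normed, ENNReal.ofReal_one] at h
  rw [h]
  exact lintegral_congr fun t => Real.enorm_of_nonneg (φ.nonneg_normed t)

/-- Mollifications of a locally integrable function evaluated at shifted points converge almost
everywhere, as long as the shift is at most a fixed multiple of the mollification radius. -/
theorem ContDiffBump.ae_tendsto_convolution_add [CompleteSpace V] {g : E → V}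
    (hg : LocallyIntegrable g μ)
    {φ : ℕ → ContDiffBump (0 : E)} {w : ℕ → E} {K K' : ℝ}
    (hφ : Tendsto (fun j => (φ j).rOut) atTop (𝓝 0)) (hφ' : ∀ j, (φ j).rOut ≤ K' * (φ j).rIn)
    (hw : ∀ j, ‖w j‖ ≤ K * (φ j).rOut) :
    ∀ᵐ x ∂μ, Tendsto (fun j => ((φ j).normed μ ⋆[lsmul ℝ ℝ, μ] g) (x + w j)) atTop (𝓝 (g x)) := by
  filter_upwards [IsUnifLocDoublingMeasure.ae_tendsto_average_norm_sub μ hg K] with x hx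
  have h0 : Tendsto (fun j => (φ j).rOut) atTop (𝓝[>] 0) :=
    tendsto_nhdsWithin_iff.2 ⟨hφ, Eventually.of_forall fun j => (φ j).rOut_pos⟩
  have h1 := hx (fun j => x + w j) (fun j => (φ j).rOut) h0
    (Eventually.of_forall fun j => by simpa [dist_eq_norm] using hw j)
  simp only [convolution_eq_swap, lsmul_apply]
  refine tendsto_integral_smul_of_tendsto_average_norm_sub (K' ^ Module.finrank ℝ E) h1 ?_ ?_ ?_ ?_
  · exact Eventually.of_forall fun j => hg.integrableOn_isCompact (isCompact_closedBall _ _)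
  · refine tendsto_const_nhds.congr fun j => ?_
    rw [integral_sub_left_eq_self (fun y => (φ j).normed μ y), (φ j).integral_normed]
  · refine Eventually.of_forall fun j y hy => ?_
    have hy' : x + w j - y ∈ Function.support ((φ j).normed μ) := hy
    rw [(φ j).support_normed_eq, mem_ball_zero_iff] at hy'
    rw [Metric.mem_closedBall, dist_comm, dist_eq_norm]
    exact hy'.le
  · refine Eventually.of_forall fun j y => ?_
    rw [abs_of_nonneg ((φ j).nonneg_normed _), Measure.addHaar_real_closedBall_center]
    exact (φ j).normed_le_div_measure_closedBall_rOut _ _ (hφ' j) _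

end

section
open scoped Convolution
open ContinuousLinearMap Filter Topology
variable {n : ℕ} {Ω : Set (EuclideanSpace ℝ (Fin n))} {u : EuclideanSpace ℝ (Fin n) → ℝ}
  {G : EuclideanSpace ℝ (Fin n) → EuclideanSpace ℝ (Fin n)}

/-- Away from the boundary, at the scale of the mollifier, the derivative of a mollified function
is the mollification of its weak gradient. -/
theorem HasWeakGradient.fderiv_convolution (hΩ : IsOpen Ω) (hG : HasWeakGradient Ω u G)
    (hu : LocallyIntegrable (Ω.indicator u)) (hGi : LocallyIntegrable (Ω.indicator G))
    {ψ : EuclideanSpace ℝ (Fin n) → ℝ} (hψ : ContDiff ℝ ∞ ψ) (hc : HasCompactSupport ψ)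
    {x : EuclideanSpace ℝ (Fin n)} (hx : ∀ y, x - y ∈ tsupport ψ → y ∈ Ω) :
    fderiv ℝ (ψ ⋆[lsmul ℝ ℝ, volume] Ω.indicator u) x
      = innerSL ℝ ((ψ ⋆[lsmul ℝ ℝ, volume] Ω.indicator G) x) := by
  have hψ1 : ContDiff ℝ 1 ψ := hψ.of_le (by simp)
  have hd := (hc.hasFDerivAt_convolution_left (lsmul ℝ ℝ) hψ1 hu x).fderiv
  rw [hd]
  refine ContinuousLinearMap.coe_injective ((EuclideanSpace.basisFun (Fin n) ℝ).toBasis.ext ?_)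
  intro i
  have hd' := hc.fderiv (𝕜 := ℝ)
  have hint : Integrable fun t => (lsmul ℝ ℝ).precompL (EuclideanSpace ℝ (Fin n))
      (fderiv ℝ ψ t) (Ω.indicator u (x - t)) :=
    hd'.convolutionExists_left _ (hψ1.continuous_fderiv one_ne_zero) hu x
  have hintG : Integrable fun t => lsmul ℝ ℝ (ψ t) (Ω.indicator G (x - t)) :=
    hc.convolutionExists_left _ hψ1.continuous hGi x
  set η : EuclideanSpace ℝ (Fin n) → ℝ := fun y => ψ (x - y) with hη
  have hηc : HasCompactSupport η :=
    hc.comp_homeomorph (Homeomorph.subLeft x)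
  have hηs : tsupport η ⊆ Ω := by
    intro y hy
    refine hx y ?_
    have := tsupport_comp_subset_preimage (f := fun y => x - y) ψ (by fun_prop) hy
    exact this
  have hηd : ∀ y v, fderiv ℝ η y v = - fderiv ℝ ψ (x - y) v := by
    intro y v
    have h1 : HasFDerivAt (fun y => x - y) (-ContinuousLinearMap.id ℝ _) y :=
      (hasFDerivAt_id y).const_sub x
    have h2 :=
      ((hψ1.differentiable one_ne_zero).differentiableAt (x := x - y)).hasFDerivAt.comp y h1
    rw [show η = ψ ∘ fun y => x - y from rfl, h2.fderiv]
    simp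
  have hw := hG η (hψ.comp (contDiff_const.sub contDiff_id)) hηc hηs i
  rw [← integral_indicator hΩ.measurableSet, ← integral_indicator hΩ.measurableSet] at hw
  simp only [OrthonormalBasis.coe_toBasis, EuclideanSpace.basisFun_apply, convolution_def,
    coe_coe, innerSL_apply_apply]
  have hcoord : inner ℝ (∫ t, lsmul ℝ ℝ (ψ t) (Ω.indicator G (x - t)))
      (EuclideanSpace.single i 1) = ∫ t, ψ t * Ω.indicator G (x - t) i := by
    have := (EuclideanSpace.proj i : EuclideanSpace ℝ (Fin n) →L[ℝ] ℝ).integral_comp_comm hintG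
    simp only [lsmul_apply, map_smul, smul_eq_mul] at this
    simpa [EuclideanSpace.inner_single_right] using this.symm
  refine (ContinuousLinearMap.integral_apply hint _).trans ?_
  rw [hcoord, ← integral_sub_left_eq_self _ _ x, ← integral_sub_left_eq_self
    (fun t => ψ t * Ω.indicator G (x - t) i) _ x]
  refine Eq.trans (Eq.trans ?_ (congrArg Neg.neg hw)) ?_
  · rw [← integral_neg]
    refine integral_congr_ae (Eventually.of_forall fun t => ?_)
    by_cases ht : t ∈ Ω
    · simp [ht, hηd, mul_comm]
    · simp [ht]
  · rw [neg_neg]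
    refine integral_congr_ae (Eventually.of_forall fun t => ?_)
    by_cases ht : t ∈ Ω
    · simp [ht, hη, mul_comm]
    · simp [ht]
end

/-! ### Directions pointing into a Lipschitz domain -/

/-- A nonempty open subset of a finite-dimensional space contains a basis. -/
theorem IsOpen.exists_basis_mem {n : ℕ} {E : Type*} [NormedAddCommGroup E] [NormedSpace ℝ E]
    [FiniteDimensional ℝ E] (hE : Module.finrank ℝ E = n) {U : Set E} (hU : IsOpen U)
    (hne : U.Nonempty) : ∃ b : Module.Basis (Fin n) ℝ E, ∀ i, b i ∈ U := by
  have hs : ⊤ ≤ Submodule.span ℝ U := by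
    have h : affineSpan ℝ U = ⊤ := affineSpan_eq_top_of_nonempty_interior
      (hne.mono (hU.subset_interior_iff.2 (subset_convexHull ℝ U)))
    intro x _
    exact affineSpan_le_toAffineSubspace_span (k := ℝ) (by rw [h]; trivial : x ∈ affineSpan ℝ U)
  set b := Module.Basis.ofSpan hs
  have : Fintype ((linearIndepOn_empty ℝ id).extend (Set.empty_subset U)) :=
    FiniteDimensional.fintypeBasisIndex b
  refine ⟨b.reindex (Fintype.equivFinOfCardEq ?_), fun i => ?_⟩
  · rw [← Module.finrank_eq_card_basis b, hE]
  · rw [Module.Basis.reindex_apply]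
    exact Module.Basis.ofSpan_subset hs ⟨_, rfl⟩

section
variable {n : ℕ} {Ω : Set (EuclideanSpace ℝ (Fin n))}
open Filter Topology Metric

/-- The Sobolev inequality for smooth functions on `Ω`, when moving in directions of the open set
`U` does not leave `Ω` inside the support of the function: after a linear change of coordinates whose
basis vectors lie in `-U`, this is `lintegral_enorm_pow_six_le`. -/
theorem exists_const_lintegral_enorm_pow_six_le (hn : 1 ≤ n) (hn3 : n ≤ 3)
    (hΩ : MeasurableSet Ω) {U : Set (EuclideanSpace ℝ (Fin n))} (hU : IsOpen U)
    (hne : U.Nonempty) :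
    ∃ C : ENNReal, C ≠ ⊤ ∧ ∀ v : EuclideanSpace ℝ (Fin n) → ℝ, ContDiff ℝ 1 v →
      HasCompactSupport v →
      (∀ x ∈ Ω, v x ≠ 0 → ∀ z ∈ U, ∀ t : ℝ, 0 ≤ t →
        x + t • z ∈ Ω ∨ fderiv ℝ v (x + t • z) = 0) →
      ∫⁻ x in Ω, ‖v x‖ₑ ^ 6 ≤
        C * ((∫⁻ x in Ω, ‖v x‖ₑ ^ 2) + ∫⁻ x in Ω, ‖fderiv ℝ v x‖ₑ ^ 2) ^ 3 := by
  obtain ⟨b, hb⟩ := hU.neg.exists_basis_mem (n := n) (by simp) hne.neg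
  set L : (Fin n → ℝ) ≃L[ℝ] EuclideanSpace ℝ (Fin n) := b.equivFunL.symm with hL
  have hLu : ∀ x i t, L (Function.update x i t) = L x + (x i - t) • (-b i) := by
    intro x i t
    have h : Function.update x i t = x + (t - x i) • Pi.single i (1 : ℝ) := by
      ext k
      by_cases hk : k = i
      · subst hk; simp
      · simp [hk]
    have h2 : L (Pi.single i 1) = b i := by
      change b.equivFun.symm (Pi.single i 1) = b i
      simp [Module.Basis.equivFun_symm_apply]
    rw [h, map_add, map_smul, h2, smul_neg, ← neg_smul, neg_sub]
  have hLm : Measurable L := L.continuous.measurable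
  have : (Measure.map L (volume : Measure (Fin n → ℝ))).IsAddHaarMeasure :=
    L.isAddHaarMeasure_map volume
  set c := Measure.addHaarScalarFactor (volume : Measure (EuclideanSpace ℝ (Fin n)))
    (Measure.map L volume)
  have hc : (volume : Measure (EuclideanSpace ℝ (Fin n))) = c • Measure.map L volume :=
    Measure.isAddLeftInvariant_eq_smul _ _
  set c' := Measure.addHaarScalarFactor (Measure.map L volume)
    (volume : Measure (EuclideanSpace ℝ (Fin n)))
  have hc' : Measure.map L volume = c' • (volume : Measure (EuclideanSpace ℝ (Fin n))) :=
    Measure.isAddLeftInvariant_eq_smul _ _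
  have hmap : ∀ f : EuclideanSpace ℝ (Fin n) → ENNReal, Measurable f →
      ∫⁻ y in L ⁻¹' Ω, f (L y) = ∫⁻ x in Ω, f x ∂(Measure.map L volume) :=
    fun f hf => (setLIntegral_map hΩ hf hLm).symm
  have h1 : ∀ f : EuclideanSpace ℝ (Fin n) → ENNReal, Measurable f →
      ∫⁻ x in Ω, f x = c * ∫⁻ y in L ⁻¹' Ω, f (L y) := by
    intro f hf
    rw [hmap f hf]
    conv_lhs => rw [hc]
    rw [Measure.restrict_smul, lintegral_smul_measure]
    rfl
  have h2 : ∀ f : EuclideanSpace ℝ (Fin n) → ENNReal, Measurable f →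
      ∫⁻ y in L ⁻¹' Ω, f (L y) = c' * ∫⁻ x in Ω, f x := by
    intro f hf
    rw [hmap f hf, hc', Measure.restrict_smul, lintegral_smul_measure]
    rfl
  set ℓ : ENNReal := ‖(L : (Fin n → ℝ) →L[ℝ] EuclideanSpace ℝ (Fin n))‖ₑ
  refine ⟨c * 4096 * (c' * (1 + ℓ ^ 2)) ^ 3, by finiteness, fun v hv hvc hvU => ?_⟩
  have hvcont := hv.continuous
  have hdcont : Continuous (fderiv ℝ v) := hv.continuous_fderiv one_ne_zero
  have hfd : ∀ y, fderiv ℝ (v ∘ L) y = (fderiv ℝ v (L y)).comp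
      (L : (Fin n → ℝ) →L[ℝ] EuclideanSpace ℝ (Fin n)) := fun y =>
    ((hv.differentiable one_ne_zero).differentiableAt.hasFDerivAt.comp y L.hasFDerivAt).fderiv
  have key := lintegral_enorm_pow_six_le (W := v ∘ L) (S := L ⁻¹' Ω) hn hn3
    (hv.comp L.contDiff) (hvc.comp_homeomorph L.toHomeomorph) (hLm hΩ) (by
      intro x hx hWx i t ht
      rcases hvU (L x) hx hWx (-b i) (hb i) (x i - t) (by linarith) with h | h
      · left; rw [Set.mem_preimage, hLu]; exact h
      · right; rw [hfd, hLu, h]; simp)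
  have hD : ∫⁻ y in L ⁻¹' Ω, ‖fderiv ℝ (v ∘ L) y‖ₑ ^ 2
      ≤ ℓ ^ 2 * (c' * ∫⁻ x in Ω, ‖fderiv ℝ v x‖ₑ ^ 2) := by
    rw [← h2 _ (by fun_prop), ← lintegral_const_mul _ (by fun_prop)]
    refine lintegral_mono fun y => ?_
    rw [hfd, ← mul_pow, mul_comm]
    exact pow_le_pow_left' (ContinuousLinearMap.opENorm_comp_le _ _) 2
  calc ∫⁻ x in Ω, ‖v x‖ₑ ^ 6 = c * ∫⁻ y in L ⁻¹' Ω, ‖(v ∘ L) y‖ₑ ^ 6 := h1 _ (by fun_prop)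
    _ ≤ c * (4096 * ((∫⁻ y in L ⁻¹' Ω, ‖(v ∘ L) y‖ₑ ^ 2) +
          ∫⁻ y in L ⁻¹' Ω, ‖fderiv ℝ (v ∘ L) y‖ₑ ^ 2) ^ 3) := by gcongr
    _ ≤ c * (4096 * (c' * (∫⁻ x in Ω, ‖v x‖ₑ ^ 2)
          + ℓ ^ 2 * (c' * ∫⁻ x in Ω, ‖fderiv ℝ v x‖ₑ ^ 2)) ^ 3) := by
        gcongr
        exact (h2 (fun x => ‖v x‖ₑ ^ 2) (by fun_prop)).le
    _ ≤ c * (4096 * (c' * (1 + ℓ ^ 2) *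
          ((∫⁻ x in Ω, ‖v x‖ₑ ^ 2) + ∫⁻ x in Ω, ‖fderiv ℝ v x‖ₑ ^ 2)) ^ 3) := by
        gcongr
        set A := ∫⁻ x in Ω, ‖v x‖ₑ ^ 2
        set D := ∫⁻ x in Ω, ‖fderiv ℝ v x‖ₑ ^ 2
        calc c' * A + ℓ ^ 2 * (c' * D) ≤ c' * A + ℓ ^ 2 * (c' * D) + (c' * D + ℓ ^ 2 * (c' * A)) :=
              le_self_add
          _ = _ := by ring
    _ = _ := by ring

/-- Near every point of its closure, a Lipschitz domain is stable under moving in the directions of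
a nonempty open set: at a boundary point, the open cone around the axis `e` whose slope exceeds the
Lipschitz constant of the boundary. -/
theorem IsBoundedLipschitzDomain.exists_open_directions
    (hΩ : IsBoundedLipschitzDomain Ω) {x₀ : EuclideanSpace ℝ (Fin n)} (hx₀ : x₀ ∈ closure Ω) :
    ∃ (δ : ℝ) (U : Set (EuclideanSpace ℝ (Fin n))), 0 < δ ∧ IsOpen U ∧ U.Nonempty ∧
      ∀ x ∈ Ω, x ∈ ball x₀ δ → ∀ z ∈ U, ∀ t : ℝ, 0 ≤ t → x + t • z ∈ ball x₀ δ →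
        x + t • z ∈ Ω := by
  by_cases hx : x₀ ∈ Ω
  · obtain ⟨δ, hδ, hb⟩ := Metric.isOpen_iff.1 hΩ.isOpen x₀ hx
    exact ⟨δ, Set.univ, hδ, isOpen_univ, Set.univ_nonempty, fun _ _ _ _ _ _ _ h => hb h⟩
  · obtain ⟨δ, e, K, γ, hδ, he, hγ, h⟩ := hΩ.lipschitz_boundary x₀
      (by rw [hΩ.isOpen.frontier_eq]; exact ⟨hx₀, hx⟩)
    refine ⟨δ, {z | K * ‖z - inner ℝ e z • e‖ < inner ℝ e z}, hδ, ?_, ⟨e, ?_⟩, ?_⟩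
    · exact isOpen_lt (by fun_prop) (by fun_prop)
    · simp [he]
    · intro x hxΩ hxb z hz t ht hb
      rw [h _ hb]
      have h1 := (h x hxb).1 hxΩ
      have h2 := hγ.dist_le_mul (x + t • z - inner ℝ e (x + t • z) • e) (x - inner ℝ e x • e)
      have h3 : (x + t • z - inner ℝ e (x + t • z) • e) - (x - inner ℝ e x • e)
          = t • (z - inner ℝ e z • e) := by
        rw [inner_add_right, inner_smul_right]; module
      rw [dist_eq_norm (x + t • z - _), h3, norm_smul, Real.norm_of_nonneg ht, Real.dist_eq] at h2
      rw [Set.mem_ofPred_eq] at hz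
      have h4 := (abs_le.1 h2).2
      rcases ht.eq_or_lt with rfl | ht'
      · simpa using h1
      · rw [inner_add_right, inner_smul_right]
        rw [inner_add_right, inner_smul_right] at h4
        have : t * (K * ‖z - inner ℝ e z • e‖) < t * inner ℝ e z :=
          mul_lt_mul_of_pos_left hz ht'
        nlinarith

end

/-! ### The Sobolev embedding into `L⁶` -/

section
variable {n : ℕ} {Ω : Set (EuclideanSpace ℝ (Fin n))}
open Filter Topology Metric
open scoped Convolution
open ContinuousLinearMap

theorem lintegral_enorm_indicator_sq {V : Type*} [NormedAddCommGroup V] (hΩ : MeasurableSet Ω)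
    (F : EuclideanSpace ℝ (Fin n) → V) :
    ∫⁻ x, ‖Ω.indicator F x‖ₑ ^ 2 = ∫⁻ x in Ω, ‖F x‖ₑ ^ 2 := by
  rw [← lintegral_indicator hΩ]
  refine lintegral_congr fun x => ?_
  by_cases hx : x ∈ Ω <;> simp [hx]

/-- The local Sobolev embedding near a point around which `Ω` is stable under moving in the
directions of a nonempty open set. -/
theorem exists_const_lintegral_inter_ball_le (hn : 1 ≤ n) (hn3 : n ≤ 3) (hΩ : IsOpen Ω)
    {x₀ : EuclideanSpace ℝ (Fin n)} {δ : ℝ} (hδ : 0 < δ)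
    {U : Set (EuclideanSpace ℝ (Fin n))} (hU : IsOpen U) (hne : U.Nonempty)
    (hUΩ : ∀ x ∈ Ω, x ∈ ball x₀ δ → ∀ z ∈ U, ∀ t : ℝ, 0 ≤ t → x + t • z ∈ ball x₀ δ →
        x + t • z ∈ Ω) :
    ∃ C : ENNReal, C ≠ ⊤ ∧ ∀ (u : EuclideanSpace ℝ (Fin n) → ℝ)
      (G : EuclideanSpace ℝ (Fin n) → EuclideanSpace ℝ (Fin n)),
      StronglyMeasurable u → StronglyMeasurable G → MemLp u 2 (volume.restrict Ω) →
      MemLp G 2 (volume.restrict Ω) → HasWeakGradient Ω u G →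
      ∫⁻ x in Ω ∩ ball x₀ (δ / 4), ‖u x‖ₑ ^ 6 ≤
        C * ((∫⁻ x in Ω, ‖u x‖ₑ ^ 2) + ∫⁻ x in Ω, ‖G x‖ₑ ^ 2) ^ 3 := by
  have hΩm : MeasurableSet Ω := hΩ.measurableSet
  obtain ⟨C, hC, hSob⟩ := exists_const_lintegral_enorm_pow_six_le hn hn3 hΩm hU hne
  obtain ⟨e, he⟩ := hne
  obtain ⟨κ, hκ, hκU⟩ := nhds_basis_closedBall.mem_iff.1 (hU.mem_nhds he)
  let χ : ContDiffBump x₀ := ⟨δ / 4, δ / 2, by linarith, by linarith⟩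
  have hχd : ContDiff ℝ 1 χ := χ.contDiff
  obtain ⟨B, hB⟩ := (χ.hasCompactSupport.fderiv (𝕜 := ℝ)).exists_bound_of_continuous
    (hχd.continuous_fderiv one_ne_zero)
  have hB0 : 0 ≤ B := (norm_nonneg _).trans (hB x₀)
  -- mollification radii `κ ρ j`, with the mollified function evaluated at a point shifted by
  -- `ρ j • e`, so that only values at points of `x + ρ j • U` enter
  set ρ : ℕ → ℝ := fun j => δ / (4 * (‖e‖ + κ)) * (1 / ((j : ℝ) + 1)) with hρ
  have hρ0 : ∀ j, 0 < ρ j := fun j => by positivity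
  have hρle : ∀ j, ρ j * (‖e‖ + κ) ≤ δ / 4 := by
    intro j
    have h1 : 1 / ((j : ℝ) + 1) ≤ 1 := by
      rw [div_le_one (by positivity)]; linarith [(Nat.cast_nonneg j : (0 : ℝ) ≤ j)]
    calc ρ j * (‖e‖ + κ) = δ / 4 * (1 / ((j : ℝ) + 1)) := by
          simp only [hρ]; field_simp
      _ ≤ δ / 4 * 1 := by gcongr
      _ = _ := mul_one _
  have hρlim : Tendsto ρ atTop (𝓝 0) := by
    simpa only [mul_zero] using (tendsto_one_div_add_atTop_nhds_zero_nat (𝕜 := ℝ)).const_mul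
      (δ / (4 * (‖e‖ + κ)))
  let φ : ℕ → ContDiffBump (0 : EuclideanSpace ℝ (Fin n)) := fun j =>
    ⟨κ * ρ j / 2, κ * ρ j, half_pos (mul_pos hκ (hρ0 j)), half_lt_self (mul_pos hκ (hρ0 j))⟩
  refine ⟨C * (ENNReal.ofReal (2 + 2 * B ^ 2)) ^ 3, by finiteness, ?_⟩
  intro u G hum hGm hu hG hw
  have huI : StronglyMeasurable (Ω.indicator u) := hum.indicator hΩm
  have hGI : StronglyMeasurable (Ω.indicator G) := hGm.indicator hΩm
  have huloc : LocallyIntegrable (Ω.indicator u) :=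
    ((memLp_indicator_iff_restrict hΩm).2 hu).locallyIntegrable (by norm_num)
  have hGloc : LocallyIntegrable (Ω.indicator G) :=
    ((memLp_indicator_iff_restrict hΩm).2 hG).locallyIntegrable (by norm_num)
  set A := ∫⁻ x in Ω, ‖u x‖ₑ ^ 2
  set D := ∫⁻ x in Ω, ‖G x‖ₑ ^ 2
  set m : ℕ → EuclideanSpace ℝ (Fin n) → ℝ := fun j =>
    (φ j).normed volume ⋆[lsmul ℝ ℝ, volume] Ω.indicator u
  set M : ℕ → EuclideanSpace ℝ (Fin n) → EuclideanSpace ℝ (Fin n) := fun j =>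
    (φ j).normed volume ⋆[lsmul ℝ ℝ, volume] Ω.indicator G
  have hmd : ∀ j, ContDiff ℝ 1 (m j) := fun j =>
    (φ j).hasCompactSupport_normed.contDiff_convolution_left (n := 1) _
      (φ j).contDiff_normed huloc
  have hMc : ∀ j, Continuous (M j) := fun j =>
    (φ j).hasCompactSupport_normed.continuous_convolution_left _
      (φ j).continuous_normed hGloc
  have hmA : ∀ j, ∫⁻ x, ‖m j (x + ρ j • e)‖ₑ ^ 2 ≤ A := by
    intro j
    rw [lintegral_add_right_eq_self (fun x => ‖m j x‖ₑ ^ 2)]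
    refine (lintegral_enorm_convolution_sq_le (φ j).continuous_normed
      (φ j).lintegral_enorm_normed huI).trans_eq (lintegral_enorm_indicator_sq hΩm u)
  have hMD : ∀ j, ∫⁻ x, ‖M j (x + ρ j • e)‖ₑ ^ 2 ≤ D := by
    intro j
    rw [lintegral_add_right_eq_self (fun x => ‖M j x‖ₑ ^ 2)]
    refine (lintegral_enorm_convolution_sq_le (φ j).continuous_normed
      (φ j).lintegral_enorm_normed hGI).trans_eq (lintegral_enorm_indicator_sq hΩm G)
  set v : ℕ → EuclideanSpace ℝ (Fin n) → ℝ := fun j x => χ x * m j (x + ρ j • e) with hv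
  have hmsd : ∀ j, ContDiff ℝ 1 fun x => m j (x + ρ j • e) := fun j =>
    (hmd j).comp (contDiff_id.add contDiff_const)
  have hvd : ∀ j, ContDiff ℝ 1 (v j) := fun j => hχd.mul (hmsd j)
  have hvc : ∀ j, HasCompactSupport (v j) := fun j => χ.hasCompactSupport.mul_right
  -- the derivative of the mollified function inside the chart
  have hfm : ∀ j, ∀ x ∈ Ω, x ∈ closedBall x₀ (δ / 2) →
      fderiv ℝ (fun x => m j (x + ρ j • e)) x = innerSL ℝ (M j (x + ρ j • e)) := by
    intro j x hxΩ hxb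
    rw [fderiv_comp_add_right]
    refine hw.fderiv_convolution hΩ huloc hGloc (φ j).contDiff_normed
      (φ j).hasCompactSupport_normed fun y hy => ?_
    rw [(φ j).tsupport_normed_eq, mem_closedBall_zero_iff] at hy
    change _ ≤ κ * ρ j at hy
    rw [mem_closedBall] at hxb
    set z := (ρ j)⁻¹ • (y - x) with hz
    have hyz : y = x + ρ j • z := by
      rw [hz, smul_inv_smul₀ (hρ0 j).ne']; abel
    have hzU : ‖z - e‖ ≤ κ := by
      have h1 : x + ρ j • e - y = ρ j • (e - z) := by rw [hyz]; module
      rw [h1, norm_smul, Real.norm_of_nonneg (hρ0 j).le, mul_comm] at hy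
      rw [norm_sub_rev]
      exact le_of_mul_le_mul_right hy (hρ0 j)
    have hzn : ‖z‖ ≤ ‖e‖ + κ := by
      calc ‖z‖ = ‖e + (z - e)‖ := by congr 1; abel
        _ ≤ ‖e‖ + ‖z - e‖ := norm_add_le _ _
        _ ≤ _ := by gcongr
    rw [hyz]
    refine hUΩ x hxΩ (by rw [mem_ball]; linarith) z
      (hκU (by rwa [mem_closedBall, dist_eq_norm])) _ (hρ0 j).le ?_
    rw [mem_ball]
    calc dist (x + ρ j • z) x₀ ≤ dist (x + ρ j • z) x + dist x x₀ := dist_triangle _ _ _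
      _ ≤ ρ j * (‖e‖ + κ) + δ / 2 := by
          gcongr
          rw [dist_eq_norm, add_sub_cancel_left, norm_smul, Real.norm_of_nonneg (hρ0 j).le]
          gcongr
      _ < δ := by linarith [hρle j]
  have hout : ∀ j x, x ∉ closedBall x₀ (δ / 2) → fderiv ℝ (v j) x = 0 := by
    intro j x hx
    have h1 : x ∉ tsupport (v j) := fun h => hx (by
      have := tsupport_mul_subset_left h
      rwa [χ.tsupport_eq] at this)
    exact image_eq_zero_of_notMem_tsupport fun h => h1 (tsupport_fderiv_subset ℝ h)
  have hfv : ∀ j, ∀ x ∈ Ω, ‖fderiv ℝ (v j) x‖ₑ ^ 2 ≤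
      ENNReal.ofReal 2 * ‖M j (x + ρ j • e)‖ₑ ^ 2 +
        ENNReal.ofReal (2 * B ^ 2) * ‖m j (x + ρ j • e)‖ₑ ^ 2 := by
    intro j x hxΩ
    by_cases hxb : x ∈ closedBall x₀ (δ / 2)
    · have h1 : fderiv ℝ (v j) x = χ x • innerSL ℝ (M j (x + ρ j • e))
          + m j (x + ρ j • e) • fderiv ℝ χ x := by
        rw [← hfm j x hxΩ hxb]
        exact fderiv_fun_mul (hχd.differentiable one_ne_zero).differentiableAt
          ((hmsd j).differentiable one_ne_zero).differentiableAt
      have h2 : ‖fderiv ℝ (v j) x‖ ≤ ‖M j (x + ρ j • e)‖ + B * ‖m j (x + ρ j • e)‖ := by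
        rw [h1]
        refine (norm_add_le _ _).trans (add_le_add ?_ ?_)
        · rw [norm_smul, innerSL_apply_norm, Real.norm_of_nonneg χ.nonneg]
          exact mul_le_of_le_one_left (norm_nonneg _) χ.le_one
        · rw [norm_smul, mul_comm]
          gcongr
          exact hB x
      simp only [← ofReal_norm]
      rw [← ENNReal.ofReal_pow (norm_nonneg _), ← ENNReal.ofReal_pow (norm_nonneg _),
        ← ENNReal.ofReal_pow (norm_nonneg _),
        ← ENNReal.ofReal_mul (by norm_num), ← ENNReal.ofReal_mul (by positivity),
        ← ENNReal.ofReal_add (by positivity) (by positivity)]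
      refine ENNReal.ofReal_le_ofReal ((pow_le_pow_left₀ (norm_nonneg _) h2 2).trans ?_)
      nlinarith [sq_nonneg (‖M j (x + ρ j • e)‖ - B * ‖m j (x + ρ j • e)‖)]
    · have h0 : ‖fderiv ℝ (v j) x‖ₑ = 0 := by rw [← ofReal_norm, hout j x hxb]; simp
      simp [h0]
  have hvA : ∀ j, ∫⁻ x in Ω, ‖v j x‖ₑ ^ 2 ≤ A := by
    intro j
    refine (setLIntegral_le_lintegral _ _).trans ((lintegral_mono fun x => ?_).trans (hmA j))
    refine pow_le_pow_left' ?_ 2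
    rw [← ofReal_norm, ← ofReal_norm]
    refine ENNReal.ofReal_le_ofReal ?_
    rw [hv, norm_mul, Real.norm_of_nonneg χ.nonneg]
    exact mul_le_of_le_one_left (norm_nonneg _) χ.le_one
  have hvD : ∀ j, ∫⁻ x in Ω, ‖fderiv ℝ (v j) x‖ₑ ^ 2 ≤
      ENNReal.ofReal 2 * D + ENNReal.ofReal (2 * B ^ 2) * A := by
    intro j
    have hc1 : Measurable fun x => ‖M j (x + ρ j • e)‖ₑ ^ 2 :=
      ((hMc j).comp (continuous_add_const (ρ j • e))).enorm.measurable.pow_const 2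
    have hc2 : Measurable fun x => ‖m j (x + ρ j • e)‖ₑ ^ 2 :=
      (hmsd j).continuous.enorm.measurable.pow_const 2
    calc ∫⁻ x in Ω, ‖fderiv ℝ (v j) x‖ₑ ^ 2
        ≤ ∫⁻ x in Ω, (ENNReal.ofReal 2 * ‖M j (x + ρ j • e)‖ₑ ^ 2 +
          ENNReal.ofReal (2 * B ^ 2) * ‖m j (x + ρ j • e)‖ₑ ^ 2) :=
          setLIntegral_mono' hΩm (hfv j)
      _ ≤ ∫⁻ x, (ENNReal.ofReal 2 * ‖M j (x + ρ j • e)‖ₑ ^ 2 +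
          ENNReal.ofReal (2 * B ^ 2) * ‖m j (x + ρ j • e)‖ₑ ^ 2) :=
          setLIntegral_le_lintegral _ _
      _ = ENNReal.ofReal 2 * (∫⁻ x, ‖M j (x + ρ j • e)‖ₑ ^ 2) +
          ENNReal.ofReal (2 * B ^ 2) * ∫⁻ x, ‖m j (x + ρ j • e)‖ₑ ^ 2 := by
          rw [lintegral_add_left (hc1.const_mul _), lintegral_const_mul _ hc1,
            lintegral_const_mul _ hc2]
      _ ≤ _ := by
          gcongr
          · exact hMD j
          · exact hmA j
  have hv6 : ∀ j, ∫⁻ x in Ω, ‖v j x‖ₑ ^ 6 ≤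
      C * (ENNReal.ofReal (2 + 2 * B ^ 2)) ^ 3 * (A + D) ^ 3 := by
    intro j
    refine (hSob (v j) (hvd j) (hvc j) ?_).trans ?_
    · intro x hxΩ hvx z hz t ht
      by_cases hb : x + t • z ∈ closedBall x₀ (δ / 2)
      · left
        have hx : x ∈ ball x₀ (δ / 2) := by
          have h1 : x ∈ Function.support χ := left_ne_zero_of_mul hvx
          rwa [χ.support_eq] at h1
        exact hUΩ x hxΩ (ball_subset_ball (by linarith) hx) z hz t ht
          (closedBall_subset_ball (by linarith) hb)
      · exact Or.inr (hout j _ hb)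
    · rw [mul_assoc, ← mul_pow]
      gcongr
      calc (∫⁻ x in Ω, ‖v j x‖ₑ ^ 2) + ∫⁻ x in Ω, ‖fderiv ℝ (v j) x‖ₑ ^ 2
          ≤ A + (ENNReal.ofReal 2 * D + ENNReal.ofReal (2 * B ^ 2) * A) :=
            add_le_add (hvA j) (hvD j)
        _ ≤ A + (ENNReal.ofReal 2 * D + ENNReal.ofReal (2 * B ^ 2) * A)
            + (A + ENNReal.ofReal (2 * B ^ 2) * D) := le_self_add
        _ = _ := by
            rw [ENNReal.ofReal_add (by norm_num) (by positivity)]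
            norm_num
            ring
  -- pass to the limit with Fatou's lemma
  have hlim : ∀ᵐ x, Tendsto (fun j => m j (x + ρ j • e)) atTop (𝓝 (Ω.indicator u x)) := by
    refine ContDiffBump.ae_tendsto_convolution_add huloc (φ := φ) (w := fun j => ρ j • e)
      (K := ‖e‖ / κ) (K' := 2) ?_ ?_ ?_
    · simpa using hρlim.const_mul κ
    · intro j
      change κ * ρ j ≤ 2 * (κ * ρ j / 2)
      linarith
    · intro j
      change ‖ρ j • e‖ ≤ ‖e‖ / κ * (κ * ρ j)
      rw [norm_smul, Real.norm_of_nonneg (hρ0 j).le]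
      refine le_of_eq ?_
      field_simp
  calc ∫⁻ x in Ω ∩ ball x₀ (δ / 4), ‖u x‖ₑ ^ 6
      ≤ ∫⁻ x in Ω ∩ ball x₀ (δ / 4), liminf (fun j => ‖v j x‖ₑ ^ 6) atTop := by
        refine setLIntegral_mono_ae' (hΩm.inter measurableSet_ball) ?_
        filter_upwards [hlim] with x hx hxm
        have h1 : Tendsto (fun j => ‖v j x‖ₑ ^ 6) atTop (𝓝 (‖u x‖ₑ ^ 6)) := by
          have hχ1 : χ x = 1 := χ.one_of_mem_closedBall (ball_subset_closedBall hxm.2)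
          rw [Set.indicator_of_mem hxm.1] at hx
          have h2 : Tendsto (fun j => v j x) atTop (𝓝 (u x)) := by
            simpa [hv, hχ1] using hx
          exact ((ENNReal.continuous_pow 6).tendsto _).comp h2.enorm
        exact h1.liminf_eq.ge
    _ ≤ liminf (fun j => ∫⁻ x in Ω ∩ ball x₀ (δ / 4), ‖v j x‖ₑ ^ 6) atTop := by
        refine lintegral_liminf_le fun j => ?_
        have := (hvd j).continuous
        fun_prop
    _ ≤ liminf (fun _ : ℕ => C * (ENNReal.ofReal (2 + 2 * B ^ 2)) ^ 3 * (A + D) ^ 3) atTop := by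
        refine liminf_le_liminf (Eventually.of_forall fun j => ?_)
        exact (lintegral_mono_set Set.inter_subset_left).trans (hv6 j)
    _ = _ := liminf_const _

/-- The Sobolev embedding `H¹(Ω) ⊂ L⁶(Ω)` on a bounded Lipschitz domain in dimension at most three,
in integrated form. -/
theorem IsBoundedLipschitzDomain.exists_const_lintegral_enorm_pow_six_le (hn : 1 ≤ n) (hn3 : n ≤ 3)
    (hΩ : IsBoundedLipschitzDomain Ω) :
    ∃ C : ENNReal, C ≠ ⊤ ∧ ∀ (u : EuclideanSpace ℝ (Fin n) → ℝ)
      (G : EuclideanSpace ℝ (Fin n) → EuclideanSpace ℝ (Fin n)),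
      StronglyMeasurable u → StronglyMeasurable G → MemLp u 2 (volume.restrict Ω) →
      MemLp G 2 (volume.restrict Ω) → HasWeakGradient Ω u G →
      ∫⁻ x in Ω, ‖u x‖ₑ ^ 6 ≤
        C * ((∫⁻ x in Ω, ‖u x‖ₑ ^ 2) + ∫⁻ x in Ω, ‖G x‖ₑ ^ 2) ^ 3 := by
  have hcomp : IsCompact (closure Ω) := hΩ.isBounded.isCompact_closure
  suffices h : ∃ C : ENNReal, C ≠ ⊤ ∧ ∀ (u : EuclideanSpace ℝ (Fin n) → ℝ)
      (G : EuclideanSpace ℝ (Fin n) → EuclideanSpace ℝ (Fin n)),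
      StronglyMeasurable u → StronglyMeasurable G → MemLp u 2 (volume.restrict Ω) →
      MemLp G 2 (volume.restrict Ω) → HasWeakGradient Ω u G →
      ∫⁻ x in Ω ∩ closure Ω, ‖u x‖ₑ ^ 6 ≤
        C * ((∫⁻ x in Ω, ‖u x‖ₑ ^ 2) + ∫⁻ x in Ω, ‖G x‖ₑ ^ 2) ^ 3 by
    rwa [Set.inter_eq_left.2 subset_closure] at h
  refine hcomp.induction_on (p := fun s => ∃ C : ENNReal, C ≠ ⊤ ∧
    ∀ (u : EuclideanSpace ℝ (Fin n) → ℝ)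
      (G : EuclideanSpace ℝ (Fin n) → EuclideanSpace ℝ (Fin n)),
      StronglyMeasurable u → StronglyMeasurable G → MemLp u 2 (volume.restrict Ω) →
      MemLp G 2 (volume.restrict Ω) → HasWeakGradient Ω u G →
      ∫⁻ x in Ω ∩ s, ‖u x‖ₑ ^ 6 ≤
        C * ((∫⁻ x in Ω, ‖u x‖ₑ ^ 2) + ∫⁻ x in Ω, ‖G x‖ₑ ^ 2) ^ 3) ?_ ?_ ?_ ?_
  · exact ⟨0, by simp, by simp⟩
  · rintro s t hst ⟨C, hC, h⟩
    refine ⟨C, hC, fun u G h1 h2 h3 h4 h5 => ?_⟩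
    exact (lintegral_mono_set (Set.inter_subset_inter_right _ hst)).trans (h u G h1 h2 h3 h4 h5)
  · rintro s t ⟨C, hC, h⟩ ⟨C', hC', h'⟩
    refine ⟨C + C', by finiteness, fun u G h1 h2 h3 h4 h5 => ?_⟩
    rw [Set.inter_union_distrib_left, add_mul]
    exact (lintegral_union_le _ _ _).trans
      (add_le_add (h u G h1 h2 h3 h4 h5) (h' u G h1 h2 h3 h4 h5))
  · intro x₀ hx₀
    obtain ⟨δ, U, hδ, hU, hne, hUΩ⟩ := hΩ.exists_open_directions hx₀
    exact ⟨ball x₀ (δ / 4), mem_nhdsWithin_of_mem_nhds (ball_mem_nhds _ (by linarith)),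
      exists_const_lintegral_inter_ball_le hn hn3 hΩ.isOpen hδ hU hne hUΩ⟩
end

section
variable {n : ℕ} {Ω : Set (EuclideanSpace ℝ (Fin n))}

theorem eLpNorm_natCast_pow {α V : Type*} [MeasurableSpace α] {μ : Measure α}
    [NormedAddCommGroup V] (F : α → V) {k : ℕ} (hk : k ≠ 0) :
    eLpNorm F k μ ^ k = ∫⁻ x, ‖F x‖ₑ ^ k ∂μ := by
  have h := eLpNorm_nnreal_pow_eq_lintegral (f := F) (μ := μ) (p := (k : ℝ≥0))
    (by exact_mod_cast hk)
  simpa using h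

/-- The Sobolev embedding `H¹(Ω) ⊂ L⁶(Ω)` in terms of norms. -/
theorem IsBoundedLipschitzDomain.exists_const_eLpNorm_six_le (hn : 1 ≤ n) (hn3 : n ≤ 3)
    (hΩ : IsBoundedLipschitzDomain Ω) :
    ∃ C : ENNReal, C ≠ ⊤ ∧ ∀ p : SobolevH1 Ω,
      eLpNorm (p : WithLp 2 (SpaceL2 Ω × SpaceL2Vec Ω)).fst 6 (volume.restrict Ω) ≤ C * ‖p‖ₑ := by
  obtain ⟨C, hC, h⟩ := hΩ.exists_const_lintegral_enorm_pow_six_le hn hn3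
  refine ⟨C + 1, by finiteness, fun p => ?_⟩
  have h1 := h _ _ (Lp.stronglyMeasurable p.1.fst) (Lp.stronglyMeasurable p.1.snd)
    (Lp.memLp p.1.fst) (Lp.memLp p.1.snd) p.2
  have e6 := eLpNorm_natCast_pow (μ := volume.restrict Ω) p.1.fst (k := 6) (by norm_num)
  have e2 := eLpNorm_natCast_pow (μ := volume.restrict Ω) p.1.fst (k := 2) (by norm_num)
  have e2' := eLpNorm_natCast_pow (μ := volume.restrict Ω) p.1.snd (k := 2) (by norm_num)
  rw [Nat.cast_ofNat] at e6 e2 e2'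
  rw [← e6, ← e2, ← e2', ← Lp.enorm_def, ← Lp.enorm_def] at h1
  have h2 : ‖p.1.fst‖ₑ ^ 2 + ‖p.1.snd‖ₑ ^ 2 = ‖p‖ₑ ^ 2 := by
    have := WithLp.prod_norm_sq_eq_of_L2 p.1
    simp only [← ofReal_norm]
    rw [← ENNReal.ofReal_pow (norm_nonneg _), ← ENNReal.ofReal_pow (norm_nonneg _),
      ← ENNReal.ofReal_pow (norm_nonneg _), ← ENNReal.ofReal_add (by positivity) (by positivity),
      ← this]
    rfl
  rw [h2, ← pow_mul] at h1
  have h3 : eLpNorm p.1.fst 6 (volume.restrict Ω) ^ 6 ≤ ((C + 1) * ‖p‖ₑ) ^ 6 := by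
    refine h1.trans ?_
    rw [mul_pow]
    gcongr
    exact le_self_add.trans (le_self_pow₀ le_add_self (by norm_num))
  exact (ENNReal.pow_le_pow_left_iff (by norm_num)).1 h3

/-! ### Pointwise estimates of the reaction terms -/

theorem continuous_hindmarshRose (a b α β q r J c : ℝ) (i : Fin 3) :
    Continuous fun p : ℝ × ℝ × ℝ => hindmarshRose a b α β q r J c p.1 p.2.1 p.2.2 i := by
  fin_cases i <;> simp [hindmarshRose] <;> fun_prop

/-- Local Lipschitz estimate of the reaction terms, with a quadratically growing constant. -/
theorem abs_hindmarshRose_sub_le {a b β q r : ℝ} (ha : 0 ≤ a) (hb : 0 ≤ b) (hβ : 0 ≤ β)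
    (hq : 0 ≤ q) (hr : 0 ≤ r) (α J c u v w u' v' w' : ℝ) (i : Fin 3) :
    |hindmarshRose a b α β q r J c u v w i - hindmarshRose a b α β q r J c u' v' w' i| ≤
      (1 + a + 2 * b + β + q + r) *
        ((1 + u ^ 2 + u' ^ 2) * (|u - u'| + |v - v'| + |w - w'|)) := by
  set P := 1 + u ^ 2 + u' ^ 2 with hP
  have hP1 : 1 ≤ P := by nlinarith [sq_nonneg u, sq_nonneg u']
  have h1 : |u + u'| ≤ P := by
    rw [abs_le]; constructor <;> nlinarith [sq_nonneg (u + 1), sq_nonneg (u' + 1),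
      sq_nonneg (u - 1), sq_nonneg (u' - 1)]
  have h2 : |u ^ 2 + u * u' + u' ^ 2| ≤ 2 * P := by
    rw [abs_le]; constructor <;> nlinarith [sq_nonneg (u + u'), sq_nonneg (u - u')]
  have hx := abs_nonneg (u - u')
  have hy := abs_nonneg (v - v')
  have hz := abs_nonneg (w - w')
  set x := |u - u'|
  set y := |v - v'|
  set z := |w - w'|
  have hPx : x ≤ P * x := le_mul_of_one_le_left hx hP1
  have hPy : y ≤ P * y := le_mul_of_one_le_left hy hP1
  have hPz : z ≤ P * z := le_mul_of_one_le_left hz hP1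
  have hPx0 : 0 ≤ P * x := hx.trans hPx
  have hPy0 : 0 ≤ P * y := hy.trans hPy
  have hPz0 : 0 ≤ P * z := hz.trans hPz
  have e1 : |u + u'| * x ≤ P * x := by gcongr
  have e2 : |u ^ 2 + u * u' + u' ^ 2| * x ≤ 2 * P * x := by gcongr
  have hsum : P * (x + y + z) = P * x + P * y + P * z := by ring
  have hS0 : 0 ≤ P * (x + y + z) := by rw [hsum]; positivity
  have hxS : P * x ≤ P * (x + y + z) := by rw [hsum]; linarith
  have hzS : P * z ≤ P * (x + y + z) := by rw [hsum]; linarith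
  set T := P * (x + y + z)
  have ka := mul_le_mul_of_nonneg_left (e1.trans hxS) ha
  have kb := mul_le_mul_of_nonneg_left (e2.trans (by linarith : 2 * P * x ≤ 2 * T)) hb
  have kβ := mul_le_mul_of_nonneg_left (e1.trans hxS) hβ
  have kq := mul_le_mul_of_nonneg_left (hPx.trans hxS) hq
  have kr := mul_le_mul_of_nonneg_left (hPz.trans hzS) hr
  have pa := mul_nonneg ha hS0
  have pb := mul_nonneg hb hS0
  have pβ := mul_nonneg hβ hS0
  have pq := mul_nonneg hq hS0
  have pr := mul_nonneg hr hS0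
  fin_cases i
  · have : (a * u ^ 2 - b * u ^ 3) + v - w + J - ((a * u' ^ 2 - b * u' ^ 3) + v' - w' + J)
        = a * ((u + u') * (u - u')) - b * ((u ^ 2 + u * u' + u' ^ 2) * (u - u'))
          + (v - v') - (w - w') := by ring
    simp only [hindmarshRose, Fin.zero_eta, Matrix.cons_val_zero]
    rw [this]
    refine (abs_sub _ _).trans ?_
    refine (add_le_add_left (abs_add_le _ _) _).trans ?_
    refine (add_le_add_left (add_le_add_left (abs_sub _ _) _) _).trans ?_
    rw [abs_mul, abs_mul, abs_mul, abs_mul, abs_of_nonneg ha, abs_of_nonneg hb]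
    linarith
  · have : (α - β * u ^ 2) - v - ((α - β * u' ^ 2) - v')
        = -(β * ((u + u') * (u - u'))) - (v - v') := by ring
    simp only [hindmarshRose, Fin.mk_one, Matrix.cons_val_one, Matrix.cons_val_zero]
    rw [this]
    refine (abs_sub _ _).trans ?_
    rw [abs_neg, abs_mul, abs_mul, abs_of_nonneg hβ]
    linarith
  · have : q * (u - c) - r * w - (q * (u' - c) - r * w')
        = q * (u - u') - r * (w - w') := by ring
    simp only [hindmarshRose, Fin.reduceFinMk, Matrix.cons_val]
    rw [this]
    refine (abs_sub _ _).trans ?_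
    rw [abs_mul, abs_mul, abs_of_nonneg hq, abs_of_nonneg hr]
    linarith

/-- The one-sided Lipschitz estimate of the reaction terms. The cubic damping
`-b (u² + u u' + u'²) ≤ -b (u² + u'²) / 2` absorbs the quadratic growth of the terms in `a`
and `β`. -/
theorem sum_hindmarshRose_sub_mul_le {a b β q r : ℝ} (hb : 0 < b)
    (hq : 0 < q) (hr : 0 < r) (α J c u v w u' v' w' : ℝ) :
    (hindmarshRose a b α β q r J c u v w 0 - hindmarshRose a b α β q r J c u' v' w' 0) * (u - u')
    + (hindmarshRose a b α β q r J c u v w 1 - hindmarshRose a b α β q r J c u' v' w' 1) * (v - v')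
    + (hindmarshRose a b α β q r J c u v w 2 - hindmarshRose a b α β q r J c u' v' w' 2) * (w - w')
    ≤ hindmarshRoseConst a b β q r * ((u - u') ^ 2 + (v - v') ^ 2 + (w - w') ^ 2) := by
  simp only [hindmarshRose, Matrix.cons_val]
  have c1 : 1 + q + 2 * a ^ 2 / b ≤ hindmarshRoseConst a b β q r := le_max_left _ _
  have c2 : 2 + 2 * β ^ 2 / b ≤ hindmarshRoseConst a b β q r :=
    (le_max_left _ _).trans (le_max_right _ _)
  have c3 : 1 + q + r ≤ hindmarshRoseConst a b β q r :=
    (le_max_right _ _).trans (le_max_right _ _)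
  have k1 := mul_le_mul_of_nonneg_right c1 (sq_nonneg (u - u'))
  have k2 := mul_le_mul_of_nonneg_right c2 (sq_nonneg (v - v'))
  have k3 := mul_le_mul_of_nonneg_right c3 (sq_nonneg (w - w'))
  -- Young's inequality for the terms in `a` and in `β`, applied to `u` and to `u'`
  have ya : ∀ s : ℝ, a * s ≤ b / 4 * s ^ 2 + a ^ 2 / b := by
    intro s
    have : b / 4 * s ^ 2 + a ^ 2 / b - a * s = (b * s / 2 - a) ^ 2 / b := by field_simp; ring
    have : 0 ≤ (b * s / 2 - a) ^ 2 / b := by positivity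
    linarith
  have yβ : ∀ s x y : ℝ, -(β * s * x * y) ≤ b / 4 * s ^ 2 * x ^ 2 + β ^ 2 / b * y ^ 2 := by
    intro s x y
    have : b / 4 * s ^ 2 * x ^ 2 + β ^ 2 / b * y ^ 2 + β * s * x * y
        = (b * s * x / 2 + β * y) ^ 2 / b := by field_simp; ring
    have : 0 ≤ (b * s * x / 2 + β * y) ^ 2 / b := by positivity
    linarith
  have a1 := mul_le_mul_of_nonneg_right (ya u) (sq_nonneg (u - u'))
  have a2 := mul_le_mul_of_nonneg_right (ya u') (sq_nonneg (u - u'))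
  have b1 := yβ u (u - u') (v - v')
  have b2 := yβ u' (u - u') (v - v')
  have d : 0 ≤ b / 2 * ((u + u') * (u - u')) ^ 2 := by positivity
  have m1 : (u - u') * (v - v') ≤ ((u - u') ^ 2 + (v - v') ^ 2) / 2 := by
    linarith [sq_nonneg (u - u' - (v - v'))]
  have m2 : -((u - u') * (w - w')) ≤ ((u - u') ^ 2 + (w - w') ^ 2) / 2 := by
    linarith [sq_nonneg (u - u' + (w - w'))]
  have m3 : q * ((u - u') * (w - w')) ≤ q * (((u - u') ^ 2 + (w - w') ^ 2) / 2) := by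
    refine mul_le_mul_of_nonneg_left ?_ hq.le
    linarith [sq_nonneg (u - u' - (w - w'))]
  have p1 := mul_nonneg hq.le (sq_nonneg (u - u'))
  have p3 := mul_nonneg hq.le (sq_nonneg (w - w'))
  have p4 := mul_nonneg hr.le (sq_nonneg (w - w'))
  rw [mul_div_assoc] at k1 k2
  generalize a ^ 2 / b = A at *
  generalize β ^ 2 / b = B at *
  linarith [sq_nonneg (u - u'), sq_nonneg (v - v'), sq_nonneg (w - w')]
end

/-! ### The superposition operator -/

section
variable {n : ℕ} {Ω : Set (EuclideanSpace ℝ (Fin n))}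

instance holderTriple_three_six_two : ENNReal.HolderTriple 3 6 2 where
  inv_add_inv_eq_inv := by
    rw [← ENNReal.toReal_eq_toReal_iff' (by simp) (by simp), ENNReal.toReal_add (by simp) (by simp)]
    norm_num

instance holderTriple_six_six_three : ENNReal.HolderTriple 6 6 3 where
  inv_add_inv_eq_inv := by
    rw [← ENNReal.toReal_eq_toReal_iff' (by simp) (by simp), ENNReal.toReal_add (by simp) (by simp)]
    norm_num

section Holder
variable {α : Type*} [MeasurableSpace α] {μ : Measure α} {f g h k l : α → ℝ}

theorem eLpNorm_sq_three_le (hf : AEStronglyMeasurable f μ) :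
    eLpNorm (fun x => f x ^ 2) 3 μ ≤ eLpNorm f 6 μ ^ 2 := by
  have h := eLpNorm_smul_le_mul_eLpNorm (p := 6) (q := 6) (r := 3) hf hf
  rw [smul_eq_mul, ← sq, ← sq] at h
  exact h

theorem eLpNorm_one_add_sq_add_sq_le (hf : AEStronglyMeasurable f μ)
    (hg : AEStronglyMeasurable g μ) :
    eLpNorm (fun x => 1 + f x ^ 2 + g x ^ 2) 3 μ ≤
      eLpNorm (fun _ => (1 : ℝ)) 3 μ + eLpNorm f 6 μ ^ 2 + eLpNorm g 6 μ ^ 2 := by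
  have h1 : AEStronglyMeasurable (fun _ : α => (1 : ℝ)) μ := aestronglyMeasurable_const
  have hf2 : AEStronglyMeasurable (fun x => f x ^ 2) μ := hf.pow 2
  have hg2 : AEStronglyMeasurable (fun x => g x ^ 2) μ := hg.pow 2
  have h13 : (1 : ENNReal) ≤ 3 := by norm_num
  exact (eLpNorm_add_le (h1.add hf2) hg2 h13).trans
    (add_le_add ((eLpNorm_add_le h1 hf2 h13).trans (add_le_add le_rfl (eLpNorm_sq_three_le hf)))
      (eLpNorm_sq_three_le hg))

theorem eLpNorm_abs_add_abs_add_abs_le (hh : AEStronglyMeasurable h μ)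
    (hk : AEStronglyMeasurable k μ) (hl : AEStronglyMeasurable l μ) :
    eLpNorm (fun x => |h x| + |k x| + |l x|) 6 μ ≤
      eLpNorm h 6 μ + eLpNorm k 6 μ + eLpNorm l 6 μ := by
  have hn : ∀ f : α → ℝ, eLpNorm (fun x => |f x|) 6 μ = eLpNorm f 6 μ := fun f => eLpNorm_norm f
  calc eLpNorm (fun x => |h x| + |k x| + |l x|) 6 μ
      ≤ eLpNorm (fun x => |h x| + |k x|) 6 μ + eLpNorm (fun x => |l x|) 6 μ :=
        eLpNorm_add_le (hh.norm.add hk.norm) hl.norm (by norm_num)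
    _ ≤ (eLpNorm (fun x => |h x|) 6 μ + eLpNorm (fun x => |k x|) 6 μ)
          + eLpNorm (fun x => |l x|) 6 μ := by
        gcongr
        exact eLpNorm_add_le hh.norm hk.norm (by norm_num)
    _ = _ := by simp only [hn]

/-- Hölder's inequality with exponents `1/2 = 1/3 + 1/6`, for a difference bounded by a quadratic
factor times a linear one. -/
theorem eLpNorm_two_le_of_abs_le {F : α → ℝ} {K : ℝ} (hK : 0 ≤ K)
    (hf : AEStronglyMeasurable f μ) (hg : AEStronglyMeasurable g μ)
    (hh : AEStronglyMeasurable h μ) (hk : AEStronglyMeasurable k μ)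
    (hl : AEStronglyMeasurable l μ)
    (hF : ∀ᵐ x ∂μ, |F x| ≤ K * ((1 + f x ^ 2 + g x ^ 2) * (|h x| + |k x| + |l x|))) :
    eLpNorm F 2 μ ≤ ENNReal.ofReal K *
      ((eLpNorm (fun _ => (1 : ℝ)) 3 μ + eLpNorm f 6 μ ^ 2 + eLpNorm g 6 μ ^ 2) *
      (eLpNorm h 6 μ + eLpNorm k 6 μ + eLpNorm l 6 μ)) := by
  set P : α → ℝ := fun x => 1 + f x ^ 2 + g x ^ 2
  set Q : α → ℝ := fun x => |h x| + |k x| + |l x|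
  have hP : AEStronglyMeasurable P μ := (aestronglyMeasurable_const.add (hf.pow 2)).add (hg.pow 2)
  have hQ : AEStronglyMeasurable Q μ := (hh.norm.add hk.norm).add hl.norm
  refine (eLpNorm_le_mul_eLpNorm_of_ae_le_mul (g := P • Q) (c := K) (p := 2) ?_).trans ?_
  · filter_upwards [hF] with x hx
    rw [Real.norm_eq_abs]
    refine hx.trans ?_
    gcongr
    exact le_abs_self _
  · gcongr
    refine (eLpNorm_smul_le_mul_eLpNorm (p := 3) (q := 6) hQ hP).trans ?_
    gcongr
    · exact eLpNorm_one_add_sq_add_sq_le hf hg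
    · exact eLpNorm_abs_add_abs_add_abs_le hh hk hl

end Holder

theorem SpaceE.coeFn_toH_sub (g g' : SpaceE Ω) (i : Fin 3) :
    ((g - g').toH i : EuclideanSpace ℝ (Fin n) → ℝ) =ᵐ[volume.restrict Ω]
      fun x => g.toH i x - g'.toH i x :=
  Lp.coeFn_sub (g.toH i) (g'.toH i)

theorem SpaceE.exists_const_eLpNorm_toH_le (hn : 1 ≤ n) (hn3 : n ≤ 3)
    (hΩ : IsBoundedLipschitzDomain Ω) :
    ∃ C : ENNReal, C ≠ ⊤ ∧ ∀ (g : SpaceE Ω) (i : Fin 3),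
      eLpNorm (g.toH i) 6 (volume.restrict Ω) ≤ C * ‖g‖ₑ := by
  obtain ⟨C, hC, h⟩ := hΩ.exists_const_eLpNorm_six_le hn hn3
  refine ⟨C, hC, fun g i => (h (g i)).trans ?_⟩
  gcongr
  exact PiLp.enorm_apply_le g i

/-- The superposition of the Hindmarsh-Rose reaction terms with an element of `E`. -/
noncomputable def hindmarshRoseSuperposition (a b α β q r J c : ℝ) (g : SpaceE Ω) (i : Fin 3) :
    EuclideanSpace ℝ (Fin n) → ℝ :=
  fun x => hindmarshRose a b α β q r J c (g.toH 0 x) (g.toH 1 x) (g.toH 2 x) i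

variable {a b α β q r J c : ℝ}

theorem aestronglyMeasurable_hindmarshRoseSuperposition (g : SpaceE Ω) (i : Fin 3) :
    AEStronglyMeasurable (hindmarshRoseSuperposition a b α β q r J c g i)
      (volume.restrict Ω) := by
  have h0 := Lp.aestronglyMeasurable (g.toH 0)
  have h1 := Lp.aestronglyMeasurable (g.toH 1)
  have h2 := Lp.aestronglyMeasurable (g.toH 2)
  have h : AEStronglyMeasurable (fun x => (g.toH 0 x, g.toH 1 x, g.toH 2 x))
      (volume.restrict Ω) := h0.prodMk (h1.prodMk h2)
  have hc := (continuous_hindmarshRose a b α β q r J c i).comp_aestronglyMeasurable h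
  exact hc

/-- The bound for `f(g) - f(g')` behind the Lipschitz estimate; it also shows that the superposition
is square integrable, by comparison with `g' = 0`. -/
theorem eLpNorm_hindmarshRoseSuperposition_sub_le (ha : 0 ≤ a) (hb : 0 ≤ b) (hβ : 0 ≤ β)
    (hq : 0 ≤ q) (hr : 0 ≤ r) (g g' : SpaceE Ω) (i : Fin 3) :
    eLpNorm (fun x => hindmarshRoseSuperposition a b α β q r J c g i x
        - hindmarshRoseSuperposition a b α β q r J c g' i x) 2 (volume.restrict Ω) ≤
      ENNReal.ofReal (1 + a + 2 * b + β + q + r) *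
        ((eLpNorm (fun _ => (1 : ℝ)) 3 (volume.restrict Ω)
          + eLpNorm (g.toH 0) 6 (volume.restrict Ω) ^ 2
          + eLpNorm (g'.toH 0) 6 (volume.restrict Ω) ^ 2) *
        (eLpNorm ((g - g').toH 0) 6 (volume.restrict Ω)
          + eLpNorm ((g - g').toH 1) 6 (volume.restrict Ω)
          + eLpNorm ((g - g').toH 2) 6 (volume.restrict Ω))) := by
  refine eLpNorm_two_le_of_abs_le (by positivity) (Lp.aestronglyMeasurable _)
    (Lp.aestronglyMeasurable _) (Lp.aestronglyMeasurable _) (Lp.aestronglyMeasurable _)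
    (Lp.aestronglyMeasurable _) ?_
  filter_upwards [SpaceE.coeFn_toH_sub g g' 0, SpaceE.coeFn_toH_sub g g' 1,
    SpaceE.coeFn_toH_sub g g' 2] with x h0 h1 h2
  rw [h0, h1, h2]
  exact abs_hindmarshRose_sub_le ha hb hβ hq hr α J c _ _ _ _ _ _ i

theorem IsBoundedLipschitzDomain.isFiniteMeasure_volume_restrict (hΩ : IsBoundedLipschitzDomain Ω) :
    IsFiniteMeasure (volume.restrict Ω) :=
  isFiniteMeasure_restrict.2 hΩ.isBounded.measure_lt_top.ne

theorem memLp_hindmarshRoseSuperposition (hn : 1 ≤ n) (hn3 : n ≤ 3)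
    (hΩ : IsBoundedLipschitzDomain Ω) (ha : 0 ≤ a) (hb : 0 ≤ b) (hβ : 0 ≤ β)
    (hq : 0 ≤ q) (hr : 0 ≤ r) (g : SpaceE Ω) (i : Fin 3) :
    MemLp (hindmarshRoseSuperposition a b α β q r J c g i) 2 (volume.restrict Ω) := by
  have := hΩ.isFiniteMeasure_volume_restrict
  obtain ⟨C, hC, h⟩ := SpaceE.exists_const_eLpNorm_toH_le hn hn3 hΩ
  have hfin : ∀ (g : SpaceE Ω) i, eLpNorm (g.toH i) 6 (volume.restrict Ω) ≠ ⊤ := fun g i =>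
    ne_top_of_le_ne_top (ENNReal.mul_ne_top hC enorm_ne_top) (h g i)
  have h1 : eLpNorm (fun _ => (1 : ℝ)) 3 (volume.restrict Ω) ≠ ⊤ :=
    (memLp_const (1 : ℝ)).eLpNorm_ne_top
  -- the superposition with `0` is essentially constant
  have h0 : MemLp (hindmarshRoseSuperposition a b α β q r J c (0 : SpaceE Ω) i) 2
      (volume.restrict Ω) := by
    refine (memLp_congr_ae ?_).2 (memLp_const (hindmarshRose a b α β q r J c 0 0 0 i))
    have hz : ∀ i, ∀ᵐ x ∂(volume.restrict Ω), (0 : SpaceE Ω).toH i x = 0 := fun i =>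
      Lp.coeFn_zero ℝ 2 (volume.restrict Ω)
    filter_upwards [hz 0, hz 1, hz 2] with x h0 h1 h2
    simp only [hindmarshRoseSuperposition, h0, h1, h2]
  have hd : MemLp (fun x => hindmarshRoseSuperposition a b α β q r J c g i x
      - hindmarshRoseSuperposition a b α β q r J c (0 : SpaceE Ω) i x) 2 (volume.restrict Ω) := by
    refine ⟨(aestronglyMeasurable_hindmarshRoseSuperposition g i).sub
      (aestronglyMeasurable_hindmarshRoseSuperposition 0 i), ?_⟩
    refine (eLpNorm_hindmarshRoseSuperposition_sub_le ha hb hβ hq hr g 0 i).trans_lt ?_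
    have := hfin g 0
    have := hfin 0 0
    have := hfin (g - 0)
    have e0 := this 0
    have e1 := this 1
    have e2 := this 2
    finiteness
  have := hd.add h0
  refine (memLp_congr_ae (Filter.Eventually.of_forall fun x => ?_)).1 this
  simp

theorem PiLp.norm_le_two_mul {V : Fin 3 → Type*} [∀ i, NormedAddCommGroup (V i)] (x : PiLp 2 V)
    {T : ℝ} (hT : 0 ≤ T) (h : ∀ i, ‖x i‖ ≤ T) : ‖x‖ ≤ 2 * T := by
  have h1 : ‖x‖ ^ 2 ≤ (2 * T) ^ 2 := by
    rw [PiLp.norm_sq_eq_of_L2, Fin.sum_univ_three]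
    have := fun i => pow_le_pow_left₀ (norm_nonneg (x i)) (h i) 2
    nlinarith [this 0, this 1, this 2]
  exact le_of_sq_le_sq h1 (by positivity)

end

theorem lemma3p1 (n : ℕ) (hn : 1 ≤ n) (hn3 : n ≤ 3) (Ω : Set (EuclideanSpace ℝ (Fin n)))
    (hΩ : IsBoundedLipschitzDomain Ω) (a b α β q r J c : ℝ) (ha : 0 < a) (hb : 0 < b)
    (hα : 0 < α) (hβ : 0 < β) (hq : 0 < q) (hr : 0 < r) (hJ : 0 < J) :
    ∃ f : SpaceE Ω → SpaceH Ω, IsHindmarshRoseNemytskii Ω a b α β q r J c f ∧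
      (∀ M : Set (SpaceE Ω), Bornology.IsBounded M →
        ∃ C : ℝ, 0 < C ∧ ∀ g ∈ M, ∀ g' ∈ M, ‖f g - f g'‖ ≤ C * ‖g - g'‖) ∧
      0 < hindmarshRoseConst a b β q r ∧
      ∀ g g' : SpaceE Ω, inner ℝ (f g - f g') (g.toH - g'.toH)
        ≤ hindmarshRoseConst a b β q r * ‖g.toH - g'.toH‖ ^ 2 := by
  have hmem := fun (g : SpaceE Ω) i => memLp_hindmarshRoseSuperposition (α := α) (J := J) (c := c)
    hn hn3 hΩ ha.le hb.le hβ.le hq.le hr.le g i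
  set f : SpaceE Ω → SpaceH Ω := fun g => WithLp.toLp 2 fun i => (hmem g i).toLp with hf
  have hfN : IsHindmarshRoseNemytskii Ω a b α β q r J c f := fun g i => (hmem g i).coeFn_toLp
  refine ⟨f, hfN, fun M hM => ?_, ?_, fun g g' => ?_⟩
  · have := hΩ.isFiniteMeasure_volume_restrict
    obtain ⟨C, hC, hS⟩ := SpaceE.exists_const_eLpNorm_toH_le hn hn3 hΩ
    obtain ⟨R, hR⟩ := hM.exists_norm_le
    set T : ENNReal := ENNReal.ofReal (1 + a + 2 * b + β + q + r) *
      ((eLpNorm (fun _ => (1 : ℝ)) 3 (volume.restrict Ω) + (C * ENNReal.ofReal R) ^ 2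
        + (C * ENNReal.ofReal R) ^ 2) * (C + C + C)) with hT
    have hTtop : T ≠ ⊤ := by
      have h1 : eLpNorm (fun _ => (1 : ℝ)) 3 (volume.restrict Ω) ≠ ⊤ :=
        (memLp_const (1 : ℝ)).eLpNorm_ne_top
      finiteness
    refine ⟨2 * T.toReal + 1, by positivity, fun g hg g' hg' => ?_⟩
    have hb6 : ∀ g ∈ M, eLpNorm (g.toH 0) 6 (volume.restrict Ω) ≤ C * ENNReal.ofReal R := by
      intro g hg
      refine (hS g 0).trans ?_
      gcongr
      rw [← ofReal_norm]
      exact ENNReal.ofReal_le_ofReal (hR g hg)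
    have hcomp : ∀ i, ‖(f g - f g') i‖ ≤ T.toReal * ‖g - g'‖ := by
      intro i
      have h1 : ‖(f g - f g') i‖ₑ ≤ T * ‖g - g'‖ₑ := by
        have e : (f g - f g') i = ((hmem g i).sub (hmem g' i)).toLp :=
          (MemLp.toLp_sub (hmem g i) (hmem g' i)).symm
        rw [e, Lp.enorm_toLp]
        refine (eLpNorm_hindmarshRoseSuperposition_sub_le ha.le hb.le hβ.le hq.le hr.le
          g g' i).trans ?_
        rw [hT, mul_assoc, mul_assoc]
        gcongr
        · exact hb6 g hg
        · exact hb6 g' hg'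
        · rw [add_mul, add_mul]
          exact add_le_add (add_le_add (hS _ 0) (hS _ 1)) (hS _ 2)
      have h2 := ENNReal.toReal_mono (by finiteness) h1
      rwa [ENNReal.toReal_mul, toReal_enorm, toReal_enorm] at h2
    refine (PiLp.norm_le_two_mul _ (by positivity) hcomp).trans ?_
    linarith [norm_nonneg (g - g')]
  · exact lt_max_of_lt_left (by positivity)
  · rw [PiLp.inner_apply, ← real_inner_self_eq_norm_sq, PiLp.inner_apply, Fin.sum_univ_three,
      Fin.sum_univ_three]
    simp only [L2.inner_def]
    rw [← integral_add (L2.integrable_inner _ _) (L2.integrable_inner _ _),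
      ← integral_add ((L2.integrable_inner _ _).add (L2.integrable_inner _ _))
        (L2.integrable_inner _ _),
      ← integral_add (L2.integrable_inner _ _) (L2.integrable_inner _ _),
      ← integral_add ((L2.integrable_inner _ _).add (L2.integrable_inner _ _))
        (L2.integrable_inner _ _), ← integral_const_mul]
    refine integral_mono_ae
      (((L2.integrable_inner _ _).add (L2.integrable_inner _ _)).add (L2.integrable_inner _ _))
      ((((L2.integrable_inner _ _).add (L2.integrable_inner _ _)).add
        (L2.integrable_inner _ _)).const_mul _) ?_
    have hs : ∀ i, ∀ᵐ x ∂(volume.restrict Ω), (g.toH - g'.toH) i x = g.toH i x - g'.toH i x :=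
      fun i => SpaceE.coeFn_toH_sub g g' i
    have hfs : ∀ i, ∀ᵐ x ∂(volume.restrict Ω), (f g - f g') i x = f g i x - f g' i x :=
      fun i => Lp.coeFn_sub (f g i) (f g' i)
    filter_upwards [hs 0, hs 1, hs 2, hfs 0, hfs 1, hfs 2, hfN g 0, hfN g 1, hfN g 2,
      hfN g' 0, hfN g' 1, hfN g' 2] with x s0 s1 s2 t0 t1 t2 u0 u1 u2 w0 w1 w2
    simp only [s0, s1, s2, t0, t1, t2, u0, u1, u2, w0, w1, w2, RCLike.inner_apply, conj_trivial]
    have key := sum_hindmarshRose_sub_mul_le (a := a) (β := β) hb hq hr α J c (g.toH 0 x)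
      (g.toH 1 x) (g.toH 2 x) (g'.toH 0 x) (g'.toH 1 x) (g'.toH 2 x)
    linarith
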